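/- Theorem 2.3. Let $\psi=\Gamma'/\Gamma$ be the digamma function, $\psi',\psi''$ its first two derivatives, $\gamma$ Euler's constant, $\zeta$ the Riemann zeta function, and for $c\in\mathbb C\setminus\{0,-1,-2,\dots\}$ write $$F(c)={}_4F_3\left(\begin{matrix}1,1,1,1\\2,2,c\end{matrix}\,\middle|\,1\right)=\sum_{l=0}^{\infty}\frac{(1)_l^4}{(2)_l^2\,(c)_l\,l!},\qquad (x)_l=x(x+1)\cdots(x+l-1).$$ The series converges absolutely for $\Re c>0$, and $F$ has an analytic continuation from this half-plane to $\mathbb C\setminus\{0,-1,-2,\dots\}$, again denoted by $F$ and used where $\Re c\le 0$. For every integer $n\ge 0$ (empty sums being $0$), $$\frac{F(\frac32+n)}{\frac12+n}=\tfrac72\zeta(3)+\tfrac12\psi''(\tfrac12+n)-\tfrac{\pi^2}{2}\psi(\tfrac12+n)-\gamma\,\psi'(\tfrac12+n)+\sum_{l=0}^{n-1}\left(\frac{\psi(1+l)}{(l-n+\frac12)^2}-\psi'(1+l)\left(\frac1{l+\frac12}+\frac1{l-n+\frac12}\right)\right)\tag{15}$$ and $$\begin{aligned}\frac{F(\frac32-n)}{\frac12-n}={}&\tfrac72\zeta(3)+\tfrac12\psi''(\tfrac12+n)-\pi^2\left[\psi(\tfrac12+n)+\tfrac32\gamma+\log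 2\right]+\psi'(\tfrac12+n)\left[2\gamma+2\log 2+\psi(n+\tfrac12)\right]\\&-\sum_{l=0}^{n-1}\left(\frac{\psi(1+l)}{(l+\frac12)^2}-\psi'(1+l)\left(\frac1{l+\frac12}+\frac1{l-n+\frac12}\right)\right).\end{aligned}\tag{16}$$ In (16) the left-hand side is given by the convergent series for $n=0,1$ and by the analytic continuation in $c$ for $n\ge2$. In particular, $${}_4F_3\left(\begin{matrix}1,1,1,1\\2,2,\frac12\end{matrix}\,\middle|\,1\right)=\tfrac74\zeta(3)+\tfrac{\pi^2}{2}(1-\log 2),\tag{17a}$$ $${}_4F_3\left(\begin{matrix}1,1,1,1\\2,2,\frac32\end{matrix}\,\middle|\,1\right)=-\tfrac74\zeta(3)+\tfrac{\pi^2}{2}\log 2.\tag{17b}$$ -/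

import Mathlib

open scoped Real

/-- The `l`-th term of the generalized hypergeometric series `pFq(a; b; z)`, namely
`(∏ᵢ (aᵢ)_l / ∏ⱼ (bⱼ)_l) * z ^ l / l!`, where `(x)_l = x (x + 1) ⋯ (x + l - 1)` is the rising
factorial. The multiset `a` lists the upper parameters and `b` the lower parameters. -/
noncomputable def hypergeometricTerm (a b : Multiset ℂ) (z : ℂ) (l : ℕ) : ℂ :=
  (a.map fun x => (ascPochhammer ℂ l).eval x).prod /
    (b.map fun x => (ascPochhammer ℂ l).eval x).prod * (z ^ l / (l.factorial : ℂ))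

/-- The sum of the generalized hypergeometric series `pFq(a; b; z)`
(meaningful when the series converges). -/
noncomputable def hypergeometric (a b : Multiset ℂ) (z : ℂ) : ℂ :=
  ∑' l : ℕ, hypergeometricTerm a b z l

/-- `G` is the analytic continuation of `c ↦ 4F3(1, 1, 1, 1; 2, 2, c; 1)` from the half-plane
`0 < Re c`, on which the series converges, to the connected open set
`ℂ ∖ {0, -1, -2, …}`. -/
structure IsContinuationOf4F3 (G : ℂ → ℂ) : Prop where
  holomorphic : DifferentiableOn ℂ G {c : ℂ | ∀ k : ℕ, c ≠ -(k : ℂ)}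
  eq_series : ∀ c : ℂ, 0 < c.re → G c = hypergeometric {1, 1, 1, 1} {2, 2, c} 1

/-- The polygamma function `ψ^(m)`, the `m`-th derivative of the digamma function `ψ`. -/
noncomputable def polygamma (m : ℕ) (x : ℂ) : ℂ := iteratedDeriv m Complex.digamma x

/-! Everything rests on the recurrence F(c) = ψ'(c) + ((c-1)/c) F(c+1), `hypergeometric_add_one`. It
is a termwise identity once ψ' is expanded in inverse factorials, ψ'(c) = ∑ l!/((l+1) (c)_{l+1}),
which is `hasSum_trigammaTerm`.

Divided by c-1 the recurrence telescopes, so F(c)/(c-1) = ∑ ψ'(c+j)/(c+j-1) for Re c > 1. At c =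
3/2, inserting ψ'(s) = ∑ 1/(s+r)² turns this into the double sum of 1/(x(x+y)²) over x ∈ ℕ+1/2, y ∈
ℕ+1. `tsum_inv_half_mul_add_sq` evaluates it by summing 1/(xy(x+y)) in several orders and solving
the resulting linear relations; this gives F(3/2).

The recurrence also continues F to the left, one unit strip at a time, and by the identity theorem
it holds for every continuation (`IsContinuationOf4F3.add_one`). Both families of values then follow
by induction on n from F(3/2): to the right with the recurrence at 3/2+n, to the left with it at
1/2-n, where ψ'(1/2-n) = π² - ψ'(1/2+n). The change in the finite sums is computed in
`sum_range_shift_first` and `sum_range_shift_second`. -/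

open Filter Topology

/-! ### The domain, and functional equations of ψ' and ψ''. -/

/-- The domain `ℂ ∖ {0, -1, -2, …}`. -/
def polygammaDomain : Set ℂ := {c : ℂ | ∀ k : ℕ, c ≠ -(k : ℂ)}

/-- The excluded points are exactly the zeros of the entire function 1/Γ. -/
theorem isOpen_polygammaDomain : IsOpen polygammaDomain := by
  have h : polygammaDomain = {s : ℂ | (Complex.Gamma s)⁻¹ ≠ 0} := by
    ext s
    simp [polygammaDomain, Complex.Gamma_eq_zero_iff]
  rw [h]
  exact isOpen_ne_fun Complex.differentiable_one_div_Gamma.continuous continuous_const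

/-- Removing a countable set from a real plane leaves it path connected. Connectedness lets the
identity theorem reach the whole domain. -/
theorem isPreconnected_polygammaDomain : IsPreconnected polygammaDomain := by
  have h : polygammaDomain = (Set.range fun k : ℕ => -(k : ℂ))ᶜ := by
    ext s
    simp [polygammaDomain, eq_comm]
  rw [h]
  refine ((Set.countable_range _).isPathConnected_compl_of_one_lt_rank ?_).isConnected.isPreconnected
  rw [Complex.rank_real_complex]
  norm_num

theorem mem_polygammaDomain_of_re_pos {s : ℂ} (hs : 0 < s.re) : s ∈ polygammaDomain := by
  rintro k rfl
  simp at hs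
  linarith [(Nat.cast_nonneg k : (0 : ℝ) ≤ k)]

theorem add_one_mem_polygammaDomain {s : ℂ} (hs : s ∈ polygammaDomain) :
    s + 1 ∈ polygammaDomain := by
  intro k hk
  apply hs (k + 1)
  push_cast
  linear_combination hk

theorem ne_zero_of_mem_polygammaDomain {s : ℂ} (hs : s ∈ polygammaDomain) : s ≠ 0 := by
  simpa using hs 0

theorem differentiableOn_digamma : DifferentiableOn ℂ Complex.digamma polygammaDomain := by
  intro s hs
  have h : DifferentiableOn ℂ Complex.Gamma polygammaDomain := fun z hz =>
    (Complex.differentiableAt_Gamma z hz).differentiableWithinAt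
  exact ((h.deriv isOpen_polygammaDomain) s hs).div (h s hs) (Complex.Gamma_ne_zero hs)

theorem polygamma_one : polygamma 1 = deriv Complex.digamma := by
  funext s
  simp [polygamma]

theorem polygamma_two : polygamma 2 = deriv (polygamma 1) := by
  funext s
  simp only [polygamma_one, polygamma]
  rw [iteratedDeriv_succ, iteratedDeriv_one]

theorem differentiableOn_polygamma_one :
    DifferentiableOn ℂ (polygamma 1) polygammaDomain := by
  rw [polygamma_one]
  exact differentiableOn_digamma.deriv isOpen_polygammaDomain

theorem polygamma_one_add_one {s : ℂ} (hs : s ∈ polygammaDomain) :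
    polygamma 1 (s + 1) = polygamma 1 s - 1 / s ^ 2 := by
  rw [polygamma_one, ← deriv_comp_add_const]
  have h : (fun z => Complex.digamma (z + 1)) =ᶠ[𝓝 s] fun z => Complex.digamma z + z⁻¹ := by
    filter_upwards [isOpen_polygammaDomain.mem_nhds hs] with z hz
    exact Complex.digamma_apply_add_one z hz
  rw [h.deriv_eq]
  have hd := (differentiableOn_digamma.differentiableAt
    (isOpen_polygammaDomain.mem_nhds hs)).hasDerivAt
  rw [(hd.fun_add (hasDerivAt_inv (ne_zero_of_mem_polygammaDomain hs))).deriv]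
  ring

theorem polygamma_two_add_one {s : ℂ} (hs : s ∈ polygammaDomain) :
    polygamma 2 (s + 1) = polygamma 2 s + 2 / s ^ 3 := by
  have hs0 := ne_zero_of_mem_polygammaDomain hs
  rw [polygamma_two, ← deriv_comp_add_const]
  have h : (fun z => polygamma 1 (z + 1)) =ᶠ[𝓝 s] fun z => polygamma 1 z - (z ^ 2)⁻¹ := by
    filter_upwards [isOpen_polygammaDomain.mem_nhds hs] with z hz
    rw [polygamma_one_add_one hz, one_div]
  rw [h.deriv_eq]
  have hd := (differentiableOn_polygamma_one.differentiableAt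
    (isOpen_polygammaDomain.mem_nhds hs)).hasDerivAt
  rw [(hd.fun_sub ((hasDerivAt_pow 2 s).fun_inv (pow_ne_zero 2 hs0))).deriv]
  field_simp
  ring

/-! ### Series for ψ, ψ', ψ'' on the right half-plane. -/

theorem norm_add_natCast_ge {s : ℂ} {b : ℝ} (hs : b ≤ s.re) (k : ℕ) : b + k ≤ ‖s + k‖ :=
  calc b + k ≤ (s + k).re := by simpa using hs
    _ ≤ ‖s + k‖ := Complex.re_le_norm _

theorem summable_one_div_add_pow {b : ℝ} (hb : 0 < b) {m : ℕ} (hm : 2 ≤ m) :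
    Summable fun k : ℕ => 1 / (b + k) ^ m := by
  have h := (Real.summable_one_div_nat_add_rpow b m).2 (by exact_mod_cast hm)
  refine h.congr fun k => ?_
  rw [abs_of_pos (by positivity), Real.rpow_natCast, add_comm]

/-- Termwise differentiation of a series on the right half-plane whose derivatives have norms `C / ‖z + k‖ ^ m`. -/
theorem hasDerivAt_tsum_halfPlane {f f' : ℕ → ℂ → ℂ} {s z₀ : ℂ} (hs : 0 < s.re) (hz₀ : 0 < z₀.re)
    {C : ℝ} {m : ℕ} (hm : 2 ≤ m)
    (hf : ∀ k, ∀ z : ℂ, 0 < z.re → HasDerivAt (f k) (f' k z) z)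
    (hf' : ∀ k, ∀ z : ℂ, 0 < z.re → ‖f' k z‖ = C / ‖z + k‖ ^ m)
    (h₀ : Summable fun k => f k z₀) :
    HasDerivAt (fun z => ∑' k, f k z) (∑' k, f' k s) s := by
  -- Halving puts both s and z₀ strictly inside Re z > b, where the derivatives have a uniform
  -- summable bound.
  set b := min s.re z₀.re / 2 with hb
  have hb0 : 0 < b := by positivity
  have hC : 0 ≤ C := by
    by_contra! h
    have h1 := hf' 0 1 (by simp)
    have h2 := norm_nonneg (f' 0 1)
    rw [h1] at h2
    simp at h2
    linarith
  refine hasDerivAt_tsum_of_isPreconnected (u := fun k : ℕ => C * (1 / (b + k) ^ m))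
    (t := {z : ℂ | b < z.re}) (y₀ := z₀) ((summable_one_div_add_pow hb0 hm).mul_left C)
    (isOpen_lt continuous_const Complex.continuous_re)
    (convex_halfSpace_re_gt b).isPreconnected
    (fun k z hz => hf k z (hb0.trans hz)) (fun k z hz => ?_) ?_ h₀ ?_
  · rw [hf' k z (hb0.trans hz), ← mul_one_div]
    have := norm_add_natCast_ge (le_of_lt (show b < z.re from hz)) k
    gcongr
  · have := min_le_right s.re z₀.re
    show b < z₀.re
    linarith
  · have := min_le_left s.re z₀.re
    show b < s.re
    linarith

/-- Log-convexity of Γ, as in Bohr–Mollerup, traps ψ: comparing derivative and slope on [y, y+1]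
gives ψ(y) ≤ log y ≤ ψ(y+1). Hence ψ(x+N) - log N → 0. Unrolling ψ(x+N) by the functional equation
and comparing with H_N - log N → γ gives the limit. -/
theorem tendsto_sum_digamma_real {x : ℝ} (hx : 0 < x) :
    Tendsto (fun N : ℕ => ∑ k ∈ Finset.range N, (1 / ((k : ℂ) + 1) - 1 / ((x : ℂ) + k))) atTop
      (𝓝 (Complex.digamma x + Real.eulerMascheroniConstant)) := by
  let f := Real.log ∘ Real.Gamma
  have hc : ConvexOn ℝ (Set.Ioi 0) f := Real.convexOn_log_Gamma
  have hdG {x : ℝ} (hx : 0 < x) : DifferentiableAt ℝ Real.Gamma x :=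
    Real.differentiableAt_Gamma fun m => ne_of_gt (by linarith [(Nat.cast_nonneg m : (0:ℝ) ≤ m)])
  have hder {x : ℝ} (hx : 0 < x) : DifferentiableAt ℝ f x :=
    (hdG hx).log (Real.Gamma_pos_of_pos hx).ne'
  have h_rec (x : ℝ) (hx : 0 < x) : f (x + 1) = f x + Real.log x := by
    simp only [f, Function.comp_apply, Real.Gamma_add_one hx.ne',
      Real.log_mul hx.ne' (Real.Gamma_pos_of_pos hx).ne', add_comm]
  have hdig {x : ℝ} (hx : 0 < x) : Complex.digamma x = (deriv f x : ℝ) := by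
    have h1 : deriv f x = deriv Real.Gamma x / Real.Gamma x :=
      ((hdG hx).hasDerivAt.log (Real.Gamma_pos_of_pos hx).ne').deriv
    have h2 : deriv Complex.Gamma x = (deriv Real.Gamma x : ℝ) := by
      have hd : DifferentiableAt ℂ Complex.Gamma x := Complex.differentiableAt_Gamma _
        (mem_polygammaDomain_of_re_pos (by simpa using hx))
      rw [← (funext Complex.Gamma_ofReal ▸ hd.hasDerivAt.comp_ofReal.deriv :)]
      exact (hdG hx).hasDerivAt.ofReal_comp.deriv
    rw [Complex.digamma_def, logDeriv_apply, h1, h2, Complex.Gamma_ofReal, Complex.ofReal_div]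
  have hsum (N : ℕ) : deriv f (x + N) = deriv f x + ∑ k ∈ Finset.range N, 1 / (x + k) := by
    induction N with
    | zero => simp
    | succ n ih =>
      have hxn : 0 < x + n := by positivity
      have h := Complex.digamma_apply_add_one ((x + n : ℝ) : ℂ)
        (mem_polygammaDomain_of_re_pos (by simpa using hxn))
      rw [hdig hxn, ← Complex.ofReal_one, ← Complex.ofReal_add, hdig (by positivity)] at h
      rw [Finset.sum_range_succ, ← add_assoc, ← ih, Nat.cast_succ, ← add_assoc]
      rw [← Complex.ofReal_inv] at h
      rw [one_div]
      exact_mod_cast h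
  have hub {y : ℝ} (hy : 0 < y) : deriv f y ≤ Real.log y := by
    refine (hc.deriv_le_slope (Set.mem_Ioi.2 hy) (Set.mem_Ioi.2 (by linarith : 0 < y + 1))
      (by linarith) (hder hy)).trans (le_of_eq ?_)
    rw [slope_def_field, h_rec y hy]
    ring
  have hlb {y : ℝ} (hy : 0 < y) : Real.log y ≤ deriv f (y + 1) := by
    refine (le_of_eq ?_).trans (hc.slope_le_deriv (Set.mem_Ioi.2 hy)
      (Set.mem_Ioi.2 (by linarith : 0 < y + 1)) (by linarith) (hder (by linarith)))
    rw [slope_def_field, h_rec y hy]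
    ring
  have hlog (y : ℝ) : Tendsto (fun N : ℕ => Real.log (y + N) - Real.log N) atTop (𝓝 0) := by
    have h1 : Tendsto (fun N : ℕ => y / (N : ℝ) + 1) atTop (𝓝 (0 + 1)) :=
      (tendsto_const_div_atTop_nhds_zero_nat y).add_const 1
    rw [zero_add] at h1
    have h2 := h1.log one_ne_zero
    rw [Real.log_one] at h2
    refine h2.congr' ?_
    filter_upwards [eventually_gt_atTop 0, tendsto_natCast_atTop_atTop.eventually_gt_atTop (-y)]
      with N hN hN2
    have hN' : (0 : ℝ) < N := by exact_mod_cast hN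
    rw [← Real.log_div (by linarith) hN'.ne']
    congr 1
    field_simp
  have hlim : Tendsto (fun N : ℕ => deriv f (x + N) - Real.log N) atTop (𝓝 0) := by
    refine tendsto_of_tendsto_of_tendsto_of_le_of_le' (hlog (x - 1)) (hlog x) ?_ ?_
    · filter_upwards [eventually_gt_atTop 0] with N hN
      have hN' : (1 : ℝ) ≤ N := by exact_mod_cast hN
      have := hlb (y := x - 1 + N) (by linarith)
      rw [show x - 1 + N + 1 = x + N by ring] at this
      simpa using this
    · filter_upwards with N
      simpa using hub (y := x + N) (by positivity)
  have hreal : Tendsto (fun N : ℕ => ∑ k ∈ Finset.range N, (1 / ((k : ℝ) + 1) - 1 / (x + k))) atTop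
      (𝓝 (deriv f x + Real.eulerMascheroniConstant)) := by
    have h := (Real.tendsto_harmonic_sub_log.sub hlim).const_add (deriv f x)
    rw [sub_zero] at h
    refine h.congr fun N => ?_
    rw [hsum, Finset.sum_sub_distrib, harmonic]
    push_cast
    simp only [one_div]
    ring
  rw [hdig hx]
  have h := (Complex.continuous_ofReal.tendsto _).comp hreal
  rw [Complex.ofReal_add] at h
  refine h.congr fun N => ?_
  simp

theorem hasDerivAt_digamma_series {s : ℂ} (hs : 0 < s.re) :
    HasDerivAt (fun z : ℂ => ∑' k : ℕ, (1 / ((k : ℂ) + 1) - 1 / (z + k)))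
      (∑' k : ℕ, 1 / (s + k) ^ 2) s := by
  have hne {z : ℂ} (hz : 0 < z.re) (k : ℕ) : z + k ≠ 0 := by
    intro h
    have := norm_add_natCast_ge le_rfl k (s := z)
    rw [h, norm_zero] at this
    linarith [(Nat.cast_nonneg k : (0:ℝ) ≤ k)]
  -- At the base point 1 every term vanishes, so convergence there is free.
  refine hasDerivAt_tsum_halfPlane (f := fun k z => 1 / ((k : ℂ) + 1) - 1 / (z + k))
    (f' := fun k z => 1 / (z + k) ^ 2) (z₀ := 1) (C := 1) hs (by simp) le_rfl
    (fun k z hz => ?_) (fun k z hz => by simp) ?_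
  · have h := ((hasDerivAt_id z).add_const (k : ℂ)).inv (hne hz k)
    have h2 := h.const_sub (1 / ((k : ℂ) + 1))
    refine (h2.congr_deriv ?_).congr_of_eventuallyEq (Eventually.of_forall fun w => ?_)
    · simp [neg_div]
    · simp
  · refine summable_zero.congr fun k => ?_
    rw [add_comm, sub_self]

theorem summable_digamma_series {s : ℂ} (hs : 0 < s.re) :
    Summable fun k : ℕ => (1 / ((k : ℂ) + 1) - 1 / (s + k)) := by
  set b := min s.re 1 with hb
  have hb0 : 0 < b := by positivity
  refine Summable.of_norm_bounded
    ((summable_one_div_add_pow hb0 le_rfl).mul_left ‖s - 1‖) fun k => ?_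
  have h1 := norm_add_natCast_ge (min_le_left s.re 1) k
  have h2 := norm_add_natCast_ge (s := 1) (b := b) (by simp [hb]) k
  have h1' : s + k ≠ 0 := norm_pos_iff.1 (lt_of_lt_of_le (by positivity) h1)
  have h2' : (k : ℂ) + 1 ≠ 0 := by exact_mod_cast k.succ_ne_zero
  rw [div_sub_div _ _ h2' h1', norm_div, norm_mul, add_comm (k : ℂ) 1]
  rw [show 1 * (s + k) - (1 + (k : ℂ)) * 1 = s - 1 by ring, ← mul_one_div, sq]
  gcongr

theorem digamma_eq_tsum {s : ℂ} (hs : 0 < s.re) :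
    Complex.digamma s =
      (∑' k : ℕ, (1 / ((k : ℂ) + 1) - 1 / (s + k))) - Real.eulerMascheroniConstant := by
  set H : Set ℂ := {z : ℂ | 0 < z.re}
  have hH : IsOpen H := isOpen_lt continuous_const Complex.continuous_re
  have h1 : AnalyticOnNhd ℂ Complex.digamma H :=
    (differentiableOn_digamma.mono fun z hz =>
      mem_polygammaDomain_of_re_pos hz).analyticOnNhd hH
  have h2 : AnalyticOnNhd ℂ (fun z : ℂ => (∑' k : ℕ, (1 / ((k : ℂ) + 1) - 1 / (z + k))) -
      Real.eulerMascheroniConstant) H := by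
    refine DifferentiableOn.analyticOnNhd (fun z hz => ?_) hH
    exact ((hasDerivAt_digamma_series hz).differentiableAt.sub_const _).differentiableWithinAt
  refine h1.eqOn_of_preconnected_of_frequently_eq h2
    (convex_halfSpace_re_gt 0).isPreconnected (z₀ := 1) (by simp [H]) ?_ hs
  -- The two analytic functions are compared at real points accumulating at 1, where the real limit
  -- applies.
  have hseq : Tendsto (fun n : ℕ => ((1 + 1 / ((n : ℝ) + 1) : ℝ) : ℂ)) atTop (𝓝[≠] 1) := by
    rw [tendsto_nhdsWithin_iff]
    constructor
    · have h := (tendsto_one_div_add_atTop_nhds_zero_nat (𝕜 := ℝ)).const_add 1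
      rw [add_zero] at h
      exact (Complex.continuous_ofReal.tendsto 1).comp h
    · filter_upwards with n h
      have h' : (1 : ℝ) + 1 / ((n : ℝ) + 1) = 1 := Complex.ofReal_injective h
      have : (0 : ℝ) < 1 / ((n : ℝ) + 1) := by positivity
      linarith
  refine hseq.frequently (Eventually.frequently (Eventually.of_forall fun n => ?_))
  have hx : (0 : ℝ) < 1 + 1 / ((n : ℝ) + 1) := by positivity
  have h3 := (summable_digamma_series (s := ((1 + 1 / ((n : ℝ) + 1) : ℝ) : ℂ))
    (by rwa [Complex.ofReal_re])).hasSum.tendsto_sum_nat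
  rw [tendsto_nhds_unique h3 (tendsto_sum_digamma_real hx)]
  ring

theorem polygamma_one_eq_tsum {s : ℂ} (hs : 0 < s.re) :
    polygamma 1 s = ∑' k : ℕ, 1 / (s + k) ^ 2 := by
  rw [polygamma_one]
  have h : Complex.digamma =ᶠ[𝓝 s] fun z => (∑' k : ℕ, (1 / ((k : ℂ) + 1) - 1 / (z + k))) -
      Real.eulerMascheroniConstant := by
    filter_upwards [(isOpen_lt continuous_const Complex.continuous_re).mem_nhds hs] with z hz
    exact digamma_eq_tsum hz
  rw [h.deriv_eq, ((hasDerivAt_digamma_series hs).sub_const _).deriv]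

theorem summable_one_div_complex_add_pow {s : ℂ} (hs : 0 < s.re) {m : ℕ} (hm : 2 ≤ m) :
    Summable fun k : ℕ => 1 / (s + k) ^ m := by
  refine Summable.of_norm_bounded (summable_one_div_add_pow hs hm) fun k => ?_
  rw [norm_div, norm_one, norm_pow]
  have := norm_add_natCast_ge le_rfl k (s := s)
  gcongr

theorem polygamma_two_eq_tsum {s : ℂ} (hs : 0 < s.re) :
    polygamma 2 s = ∑' k : ℕ, -2 / (s + k) ^ 3 := by
  rw [polygamma_two]
  have h : polygamma 1 =ᶠ[𝓝 s] fun z => ∑' k : ℕ, 1 / (z + k) ^ 2 := by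
    filter_upwards [(isOpen_lt continuous_const Complex.continuous_re).mem_nhds hs] with z hz
    exact polygamma_one_eq_tsum hz
  rw [h.deriv_eq]
  have hne {z : ℂ} (hz : 0 < z.re) (k : ℕ) : z + k ≠ 0 := by
    intro h
    have := norm_add_natCast_ge le_rfl k (s := z)
    rw [h, norm_zero] at this
    linarith [(Nat.cast_nonneg k : (0:ℝ) ≤ k)]
  refine (hasDerivAt_tsum_halfPlane (f := fun k z => 1 / (z + k) ^ 2)
    (f' := fun k z => -2 / (z + k) ^ 3) (z₀ := s) (C := 2) (m := 3) hs hs (by norm_num)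
    (fun k z hz => ?_) (fun k z hz => by simp) (summable_one_div_complex_add_pow hs le_rfl)).deriv
  have h := (((hasDerivAt_id z).add_const (k : ℂ)).pow 2).inv (pow_ne_zero 2 (hne hz k))
  refine (h.congr_deriv ?_).congr_of_eventuallyEq (Eventually.of_forall fun w => ?_)
  · have := hne hz k
    simp
    field_simp
  · simp

/-! ### Values of ψ' and ψ'' at 1/2. -/

/-- `∑ 1 / (k + 1/2)^m` in terms of the full sum `∑ 1 / n^m`. -/
theorem hasSum_one_div_half_add_pow {m : ℕ} {Z : ℝ}
    (h : HasSum (fun n : ℕ => 1 / (n : ℝ) ^ m) Z) :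
    HasSum (fun k : ℕ => 1 / ((k : ℝ) + 1 / 2) ^ m) ((2 ^ m - 1) * Z) := by
  have hodd : Summable fun k : ℕ => 1 / ((2 * k + 1 : ℕ) : ℝ) ^ m := by
    refine h.summable.comp_injective (i := fun k : ℕ => 2 * k + 1) fun a b hab => ?_
    simp only at hab
    omega
  have heven : Summable fun k : ℕ => 1 / ((2 * k : ℕ) : ℝ) ^ m := by
    refine h.summable.comp_injective (i := fun k : ℕ => 2 * k) fun a b hab => ?_
    simp only at hab
    omega
  have hsplit := tsum_even_add_odd (f := fun n : ℕ => 1 / (n : ℝ) ^ m) heven hodd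
  rw [h.tsum_eq] at hsplit
  have he : ∑' k : ℕ, 1 / ((2 * k : ℕ) : ℝ) ^ m = 1 / 2 ^ m * Z := by
    rw [← h.tsum_eq, ← tsum_mul_left]
    refine tsum_congr fun k => ?_
    rw [Nat.cast_mul, mul_pow, Nat.cast_two, div_mul_div_comm, one_mul]
  have h2 : (2 : ℝ) ^ m * (1 / 2 ^ m) = 1 := mul_one_div_cancel (by positivity)
  have hterm : (fun k : ℕ => 1 / ((k : ℝ) + 1 / 2) ^ m) =
      fun k : ℕ => 2 ^ m * (1 / ((2 * k + 1 : ℕ) : ℝ) ^ m) := by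
    funext k
    have h3 : ((2 * k + 1 : ℕ) : ℝ) = 2 * ((k : ℝ) + 1 / 2) := by
      push_cast
      ring
    rw [h3, mul_pow, ← one_div_mul_one_div, ← mul_assoc, h2, one_mul]
  have hval : (2 ^ m - 1) * Z = 2 ^ m * ∑' k : ℕ, 1 / ((2 * k + 1 : ℕ) : ℝ) ^ m := by
    rw [he] at hsplit
    linear_combination (-2 ^ m) * hsplit + Z * h2
  rw [hterm, hval]
  exact hodd.hasSum.mul_left (2 ^ m)

theorem hasSum_one_div_half_add_sq :
    HasSum (fun k : ℕ => 1 / ((k : ℝ) + 1 / 2) ^ 2) (π ^ 2 / 2) := by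
  convert hasSum_one_div_half_add_pow hasSum_zeta_two using 1
  ring

theorem hasSum_one_div_half_add_cube :
    HasSum (fun k : ℕ => 1 / ((k : ℝ) + 1 / 2) ^ 3) (7 * ∑' n : ℕ, 1 / (n : ℝ) ^ 3) := by
  convert hasSum_one_div_half_add_pow
    (Real.summable_one_div_nat_pow.2 (by norm_num : 1 < 3)).hasSum using 1
  norm_num

theorem riemannZeta_three_eq : riemannZeta 3 = ((∑' n : ℕ, 1 / (n : ℝ) ^ 3 : ℝ) : ℂ) := by
  have h := zeta_nat_eq_tsum_of_gt_one (by norm_num : 1 < 3)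
  push_cast at h ⊢
  exact h

theorem polygamma_one_half : polygamma 1 (1 / 2) = (π : ℂ) ^ 2 / 2 := by
  rw [polygamma_one_eq_tsum (by norm_num)]
  have h := (Complex.hasSum_ofReal.2 hasSum_one_div_half_add_sq).tsum_eq
  push_cast at h
  rw [← h]
  simp only [add_comm]

theorem polygamma_two_half : polygamma 2 (1 / 2) = -14 * riemannZeta 3 := by
  rw [polygamma_two_eq_tsum (by norm_num), riemannZeta_three_eq]
  have h := (Complex.hasSum_ofReal.2 (hasSum_one_div_half_add_cube.mul_left (-2))).tsum_eq
  rw [show (-14 : ℂ) * ((∑' n : ℕ, 1 / (n : ℝ) ^ 3 : ℝ) : ℂ) =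
    ((-2 * (7 * ∑' n : ℕ, 1 / (n : ℝ) ^ 3) : ℝ) : ℂ) by push_cast; ring, ← h]
  refine tsum_congr fun k => ?_
  push_cast
  rw [mul_one_div, add_comm]

/-! ### Rising factorials and the terms of the series. -/

theorem ascPochhammer_eval_succ_left {R : Type*} [CommSemiring R] (x : R) (l : ℕ) :
    (ascPochhammer R (l + 1)).eval x = x * (ascPochhammer R l).eval (x + 1) := by
  rw [ascPochhammer_succ_left, Polynomial.eval_mul, Polynomial.eval_X, Polynomial.eval_comp]
  simp

theorem ascPochhammer_eval_two (l : ℕ) :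
    (ascPochhammer ℂ l).eval 2 = ((l + 1).factorial : ℂ) := by
  rw [← ascPochhammer_eval_one, ascPochhammer_eval_succ_left, one_mul, one_add_one_eq_two]

theorem ascPochhammer_real_pos {b : ℝ} (hb : 0 < b) (l : ℕ) : 0 < (ascPochhammer ℝ l).eval b :=
  ascPochhammer_pos l b hb

theorem ascPochhammer_le_norm {b : ℝ} (hb : 0 < b) {c : ℂ} (hc : b ≤ c.re) (l : ℕ) :
    (ascPochhammer ℝ l).eval b ≤ ‖(ascPochhammer ℂ l).eval c‖ := by
  induction l with
  | zero => simp
  | succ l ih =>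
    rw [ascPochhammer_succ_eval, ascPochhammer_succ_eval, norm_mul]
    exact mul_le_mul ih (norm_add_natCast_ge hc l) (by positivity) (norm_nonneg _)

theorem ascPochhammer_ne_zero_of_re_pos {c : ℂ} (hc : 0 < c.re) (l : ℕ) :
    (ascPochhammer ℂ l).eval c ≠ 0 :=
  norm_pos_iff.1 ((ascPochhammer_real_pos hc l).trans_le (ascPochhammer_le_norm hc le_rfl l))

theorem hypergeometricTerm_eq (c : ℂ) (l : ℕ) :
    hypergeometricTerm {1, 1, 1, 1} {2, 2, c} 1 l =
      (l.factorial : ℂ) / (((l : ℂ) + 1) ^ 2 * (ascPochhammer ℂ l).eval c) := by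
  have h1 : (l.factorial : ℂ) ≠ 0 := by exact_mod_cast l.factorial_ne_zero
  have h2 : (l : ℂ) + 1 ≠ 0 := by exact_mod_cast l.succ_ne_zero
  simp only [hypergeometricTerm, Multiset.insert_eq_cons, Multiset.map_cons, Multiset.prod_cons,
    Multiset.map_singleton, Multiset.prod_singleton, ascPochhammer_eval_one,
    ascPochhammer_eval_two, one_pow, Nat.factorial_succ, Nat.cast_mul, Nat.cast_succ]
  rcases eq_or_ne ((ascPochhammer ℂ l).eval c) 0 with h | h
  · simp [h]
  · field_simp

/-! ### Real majorants. -/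

section RealBounds

variable {b : ℝ}

/-- Telescoping: with w_l = l!/(x+1)_l one has w_l - w_{l+1} = x · l!/(x+1)_{l+1}. -/
theorem sum_factorial_div_ascPochhammer {K : Type*} [Field K] {x : K} (hx : x ≠ 0)
    (h : ∀ l, (ascPochhammer K l).eval (x + 1) ≠ 0) (N : ℕ) :
    ∑ l ∈ Finset.range N, (l.factorial : K) / (ascPochhammer K (l + 1)).eval (x + 1) =
      (1 - (N.factorial : K) / (ascPochhammer K N).eval (x + 1)) / x := by
  induction N with
  | zero => simp
  | succ N ih =>
    have h1 := h N
    have h2 := h (N + 1)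
    rw [ascPochhammer_succ_eval] at h2
    have h3 := right_ne_zero_of_mul h2
    rw [Finset.sum_range_succ, ih, ascPochhammer_succ_eval, Nat.factorial_succ]
    push_cast
    field_simp
    ring

/-- The inverse ratio is ∏ (1 + b/i) over 1 ≤ i ≤ l, which is at least 1 + b H_l, and the harmonic
series diverges. -/
theorem tendsto_factorial_div_ascPochhammer_real (hb : 0 < b) :
    Tendsto (fun l : ℕ => (l.factorial : ℝ) / (ascPochhammer ℝ l).eval (b + 1)) atTop (𝓝 0) := by
  have key (l : ℕ) : (l.factorial : ℝ) * (1 + b * ∑ i ∈ Finset.range l, 1 / ((i : ℝ) + 1)) ≤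
      (ascPochhammer ℝ l).eval (b + 1) := by
    induction l with
    | zero => simp
    | succ l ih =>
      rw [ascPochhammer_succ_eval, Finset.sum_range_succ, Nat.factorial_succ]
      push_cast
      set H := ∑ i ∈ Finset.range l, 1 / ((i : ℝ) + 1) with hH
      have hH0 : 0 ≤ H := Finset.sum_nonneg fun i _ => by positivity
      calc ((l : ℝ) + 1) * l.factorial * (1 + b * (H + 1 / ((l : ℝ) + 1)))
          = l.factorial * ((1 + b * H) * (l + 1) + b) := by
            field_simp
            ring
        _ ≤ l.factorial * ((1 + b * H) * (l + 1) + b * (1 + b * H)) := by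
            gcongr
            nlinarith [mul_nonneg (mul_nonneg hb.le hb.le) hH0]
        _ = l.factorial * (1 + b * H) * (b + 1 + l) := by ring
        _ ≤ _ := by gcongr
  have hlim : Tendsto (fun l : ℕ => (1 + b * ∑ i ∈ Finset.range l, 1 / ((i : ℝ) + 1))⁻¹)
      atTop (𝓝 0) :=
    (tendsto_atTop_add_const_left _ 1
      (Real.tendsto_sum_range_one_div_nat_succ_atTop.const_mul_atTop hb)).inv_tendsto_atTop
  refine squeeze_zero (fun l => ?_) (fun l => ?_) hlim
  · have := ascPochhammer_real_pos (by linarith : 0 < b + 1) l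
    positivity
  · have h0 : 0 ≤ ∑ i ∈ Finset.range l, 1 / ((i : ℝ) + 1) :=
      Finset.sum_nonneg fun i _ => by positivity
    have h1 := ascPochhammer_real_pos (by linarith : 0 < b + 1) l
    rw [div_le_iff₀ h1, inv_mul_eq_div, le_div_iff₀ (by positivity)]
    exact key l

/-- Since b+1+l ≤ (1+b)(l+1), the factor 1/(l+1) pays for replacing (b)_{l+1} by b
(b+1)_{l+1}/(1+b), and the resulting series telescopes. -/
theorem summable_trigammaMajorant (hb : 0 < b) :
    Summable fun l : ℕ =>
      (l.factorial : ℝ) / (((l : ℝ) + 1) * (ascPochhammer ℝ (l + 1)).eval b) := by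
  have hb1 : 0 < b + 1 := by linarith
  have h1 : Summable fun l : ℕ =>
      (l.factorial : ℝ) / (ascPochhammer ℝ (l + 1)).eval (b + 1) := by
    refine summable_of_sum_range_le (c := 1 / b) (fun l => ?_) fun N => ?_
    · have := ascPochhammer_real_pos hb1 (l + 1)
      positivity
    · rw [sum_factorial_div_ascPochhammer hb.ne' fun l => (ascPochhammer_real_pos hb1 l).ne']
      have := ascPochhammer_real_pos hb1 N
      gcongr
      rw [sub_le_self_iff]
      positivity
  refine Summable.of_nonneg_of_le (fun l => ?_) (fun l => ?_) (h1.mul_left ((1 + b) / b))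
  · have := ascPochhammer_real_pos hb (l + 1)
    positivity
  · have := ascPochhammer_real_pos hb1 l
    rw [ascPochhammer_eval_succ_left, ascPochhammer_succ_eval, div_mul_div_comm,
      div_le_div_iff₀ (by positivity) (by positivity)]
    have h2 : b + 1 + l ≤ (1 + b) * (l + 1) := by nlinarith [(Nat.cast_nonneg l : (0:ℝ) ≤ l)]
    calc (l.factorial : ℝ) * (b * ((ascPochhammer ℝ l).eval (b + 1) * (b + 1 + l)))
        ≤ (l.factorial : ℝ) * (b * ((ascPochhammer ℝ l).eval (b + 1) * ((1 + b) * (l + 1)))) := by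
          gcongr
      _ = _ := by ring

theorem summable_hypergeometricMajorant (hb : 0 < b) :
    Summable fun l : ℕ =>
      (l.factorial : ℝ) / (((l : ℝ) + 1) ^ 2 * (ascPochhammer ℝ l).eval b) := by
  refine Summable.of_nonneg_of_le (fun l => ?_) (fun l => ?_)
    ((summable_trigammaMajorant hb).mul_left (1 + b))
  · have := ascPochhammer_real_pos hb l
    positivity
  · have := ascPochhammer_real_pos hb l
    rw [ascPochhammer_succ_eval, mul_div_assoc', div_le_div_iff₀ (by positivity) (by positivity)]
    have h2 : b + l ≤ (1 + b) * (l + 1) := by nlinarith [(Nat.cast_nonneg l : (0:ℝ) ≤ l)]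
    calc (l.factorial : ℝ) * ((l + 1) * ((ascPochhammer ℝ l).eval b * (b + l)))
        ≤ (l.factorial : ℝ) * ((l + 1) * ((ascPochhammer ℝ l).eval b * ((1 + b) * (l + 1)))) := by
          gcongr
      _ = _ := by ring

end RealBounds

/-! ### Convergence and holomorphy for Re c > 0. -/

theorem norm_hypergeometricTerm_le {b : ℝ} (hb : 0 < b) {c : ℂ} (hc : b ≤ c.re) (l : ℕ) :
    ‖hypergeometricTerm {1, 1, 1, 1} {2, 2, c} 1 l‖ ≤
      (l.factorial : ℝ) / (((l : ℝ) + 1) ^ 2 * (ascPochhammer ℝ l).eval b) := by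
  have h1 := ascPochhammer_le_norm hb hc l
  have h2 := ascPochhammer_real_pos hb l
  have h3 : ‖(l : ℂ) + 1‖ = (l : ℝ) + 1 := by
    rw [← Nat.cast_succ, Complex.norm_natCast, Nat.cast_succ]
  rw [hypergeometricTerm_eq, norm_div, norm_mul, norm_pow, h3, Complex.norm_natCast]
  gcongr

theorem summable_hypergeometricTerm {c : ℂ} (hc : 0 < c.re) :
    Summable (hypergeometricTerm {1, 1, 1, 1} {2, 2, c} 1) :=
  Summable.of_norm_bounded (summable_hypergeometricMajorant hc)
    (norm_hypergeometricTerm_le hc le_rfl)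

theorem norm_hypergeometric_le {b : ℝ} (hb : 0 < b) {c : ℂ} (hc : b ≤ c.re) :
    ‖hypergeometric {1, 1, 1, 1} {2, 2, c} 1‖ ≤
      ∑' l : ℕ, (l.factorial : ℝ) / (((l : ℝ) + 1) ^ 2 * (ascPochhammer ℝ l).eval b) :=
  tsum_of_norm_bounded (summable_hypergeometricMajorant hb).hasSum
    (norm_hypergeometricTerm_le hb hc)

theorem differentiableOn_hypergeometric :
    DifferentiableOn ℂ (fun c => hypergeometric {1, 1, 1, 1} {2, 2, c} 1) {c : ℂ | 0 < c.re} := by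
  intro c hc
  have hc' : 0 < c.re := hc
  have hopen : IsOpen {z : ℂ | c.re / 2 < z.re} :=
    isOpen_lt continuous_const Complex.continuous_re
  have h : DifferentiableOn ℂ (fun c => hypergeometric {1, 1, 1, 1} {2, 2, c} 1)
      {z : ℂ | c.re / 2 < z.re} := by
    refine Complex.differentiableOn_tsum_of_summable_norm
      (summable_hypergeometricMajorant (half_pos hc')) (fun l z hz => ?_) hopen
      fun l z hz => norm_hypergeometricTerm_le (half_pos hc') (le_of_lt hz) l
    have hz' : 0 < z.re := (half_pos hc').trans hz
    have h2 : (l : ℂ) + 1 ≠ 0 := by exact_mod_cast l.succ_ne_zero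
    simp only [hypergeometricTerm_eq]
    refine DifferentiableAt.differentiableWithinAt ?_
    refine (differentiableAt_const _).div ((differentiableAt_const _).mul
      (Polynomial.differentiable _ z)) ?_
    exact mul_ne_zero (pow_ne_zero 2 h2) (ascPochhammer_ne_zero_of_re_pos hz' l)
  exact (h.differentiableAt (hopen.mem_nhds (half_lt_self hc'))).differentiableWithinAt

/-! ### Inverse factorial expansion of ψ'. -/

/-- Only the leading factor c+N of the rising factorial is estimated using N. The gain b/(b+N) is
uniform in l, so the whole series at c+N tends to 0. -/
theorem norm_trigammaTerm_le {b : ℝ} (hb : 0 < b) {c : ℂ} (hc : b ≤ c.re) (l N : ℕ) :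
    ‖(l.factorial : ℂ) / (((l : ℂ) + 1) * (ascPochhammer ℂ (l + 1)).eval (c + N))‖ ≤
      (l.factorial : ℝ) / (((l : ℝ) + 1) * (ascPochhammer ℝ (l + 1)).eval b) * (b / (b + N)) := by
  have h1 := ascPochhammer_le_norm (by linarith : 0 < b + 1) (c := c + N + 1)
    (by simp; linarith [(Nat.cast_nonneg N : (0:ℝ) ≤ N)]) l
  have h2 := ascPochhammer_real_pos (by linarith : 0 < b + 1) l
  have h3 : ‖(l : ℂ) + 1‖ = (l : ℝ) + 1 := by
    rw [← Nat.cast_succ, Complex.norm_natCast, Nat.cast_succ]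
  have h4 := norm_add_natCast_ge hc N
  rw [norm_div, norm_mul, h3, Complex.norm_natCast, ascPochhammer_eval_succ_left,
    ascPochhammer_eval_succ_left, norm_mul]
  calc _ ≤ (l.factorial : ℝ) / ((l + 1) * ((b + N) * (ascPochhammer ℝ l).eval (b + 1))) := by
        gcongr
    _ = _ := by field_simp

theorem summable_trigammaTerm {c : ℂ} (hc : 0 < c.re) :
    Summable fun l : ℕ =>
      (l.factorial : ℂ) / (((l : ℂ) + 1) * (ascPochhammer ℂ (l + 1)).eval c) := by
  refine Summable.of_norm_bounded (summable_trigammaMajorant hc) fun l => ?_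
  simpa [hc.ne'] using norm_trigammaTerm_le hc le_rfl l 0

theorem hasSum_factorial_div_ascPochhammer {c : ℂ} (hc : 0 < c.re) :
    HasSum (fun l : ℕ => (l.factorial : ℂ) / (ascPochhammer ℂ (l + 1)).eval (c + 1)) (1 / c) := by
  have hc1 : 0 < (c + 1).re := by simp; linarith
  have hc0 : c ≠ 0 := fun h => by simp [h] at hc
  have hne := ascPochhammer_ne_zero_of_re_pos hc1
  have hs : Summable fun l : ℕ =>
      (l.factorial : ℂ) / (ascPochhammer ℂ (l + 1)).eval (c + 1) := by
    -- Each term is c times the difference of the trigamma terms at c and c+1.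
    refine ((summable_trigammaTerm hc).sub (summable_trigammaTerm hc1)).mul_left c |>.congr ?_
    intro l
    have h1 := hne l
    have h2 := hne (l + 1)
    have h3 : (l : ℂ) + 1 ≠ 0 := by exact_mod_cast l.succ_ne_zero
    rw [ascPochhammer_succ_eval] at h2
    have h4 := right_ne_zero_of_mul h2
    rw [ascPochhammer_eval_succ_left c, ascPochhammer_succ_eval l (c + 1)]
    field_simp
    ring
  convert hs.hasSum using 1
  refine (tendsto_nhds_unique hs.hasSum.tendsto_sum_nat ?_).symm
  have hw : Tendsto (fun l : ℕ => (l.factorial : ℂ) / (ascPochhammer ℂ l).eval (c + 1))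
      atTop (𝓝 0) := by
    refine squeeze_zero_norm (fun l => ?_) (tendsto_factorial_div_ascPochhammer_real hc)
    have h1 := ascPochhammer_real_pos (by linarith : 0 < c.re + 1) l
    have h2 := ascPochhammer_le_norm (by linarith : 0 < c.re + 1) (c := c + 1) (by simp) l
    rw [norm_div, Complex.norm_natCast]
    gcongr
  have h := (hw.const_sub 1).div_const c
  rw [sub_zero] at h
  exact h.congr fun N => (sum_factorial_div_ascPochhammer hc0 hne N).symm

/-- The expansion of the trigamma function in inverse factorials. -/
theorem hasSum_trigammaTerm {c : ℂ} (hc : 0 < c.re) :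
    HasSum (fun l : ℕ =>
      (l.factorial : ℂ) / (((l : ℂ) + 1) * (ascPochhammer ℂ (l + 1)).eval c))
      (polygamma 1 c) := by
  -- D(z) - D(z+1) = 1/z², because the termwise difference is 1/z times the telescoping series with
  -- sum 1/z. Since D(c+N) → 0, iterating gives D(c) = ∑ 1/(c+k)² = ψ'(c).
  set D : ℂ → ℂ := fun c => ∑' l : ℕ,
    (l.factorial : ℂ) / (((l : ℂ) + 1) * (ascPochhammer ℂ (l + 1)).eval c) with hD
  suffices h : polygamma 1 c = D c by
    rw [h]
    exact (summable_trigammaTerm hc).hasSum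
  have hrec {z : ℂ} (hz : 0 < z.re) : D z = 1 / z ^ 2 + D (z + 1) := by
    have hz1 : 0 < (z + 1).re := by simp; linarith
    have hz0 : z ≠ 0 := fun h => by simp [h] at hz
    have hne := ascPochhammer_ne_zero_of_re_pos hz1
    have h1 := ((hasSum_factorial_div_ascPochhammer hz).mul_left (1 / z)).add
      (summable_trigammaTerm hz1).hasSum
    rw [hD]
    simp only
    rw [show 1 / z ^ 2 = 1 / z * (1 / z) by field_simp, ← h1.tsum_eq]
    refine tsum_congr fun l => ?_
    have h1 := hne l
    have h2 := hne (l + 1)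
    have h3 : (l : ℂ) + 1 ≠ 0 := by exact_mod_cast l.succ_ne_zero
    rw [ascPochhammer_succ_eval] at h2
    have h4 := right_ne_zero_of_mul h2
    rw [ascPochhammer_eval_succ_left z, ascPochhammer_succ_eval l (z + 1)]
    field_simp
    ring
  have hsum (N : ℕ) : ∑ k ∈ Finset.range N, 1 / (c + k) ^ 2 = D c - D (c + N) := by
    induction N with
    | zero => simp
    | succ N ih =>
      have h1 : 0 < (c + N).re := by simp; positivity
      rw [Finset.sum_range_succ, ih, hrec h1]
      push_cast
      ring_nf
  have hlim : Tendsto (fun N : ℕ => D (c + N)) atTop (𝓝 0) := by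
    have h0 : Tendsto (fun N : ℕ => (∑' l : ℕ, (l.factorial : ℝ) /
        (((l : ℝ) + 1) * (ascPochhammer ℝ (l + 1)).eval c.re)) * (c.re / (c.re + N)))
        atTop (𝓝 0) := by
      rw [← mul_zero (∑' l : ℕ, (l.factorial : ℝ) /
        (((l : ℝ) + 1) * (ascPochhammer ℝ (l + 1)).eval c.re))]
      exact (tendsto_const_nhds.div_atTop
        (tendsto_atTop_add_const_left _ _ tendsto_natCast_atTop_atTop)).const_mul _
    refine squeeze_zero_norm (fun N => ?_) h0
    exact tsum_of_norm_bounded ((summable_trigammaMajorant hc).hasSum.mul_right _)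
      fun l => norm_trigammaTerm_le hc le_rfl l N
  have h1 := (summable_one_div_complex_add_pow hc le_rfl).hasSum.tendsto_sum_nat
  rw [← polygamma_one_eq_tsum hc] at h1
  refine tendsto_nhds_unique h1 ?_
  have h2 := hlim.const_sub (D c)
  rw [sub_zero] at h2
  exact h2.congr fun N => (hsum N).symm

/-! ### The recurrence in c and its telescoped form. -/

/-- Termwise: since c (c+1)_l = (c)_{l+1}, the common denominator is (l+1)² (c)_{l+1}, and the
numerators add up by (l+1) + (c-1) = c+l. -/
theorem hypergeometric_add_one {c : ℂ} (hc : 0 < c.re) :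
    hypergeometric {1, 1, 1, 1} {2, 2, c} 1 = polygamma 1 c +
      (c - 1) / c * hypergeometric {1, 1, 1, 1} {2, 2, c + 1} 1 := by
  have hc1 : 0 < (c + 1).re := by simp; linarith
  have hc0 : c ≠ 0 := fun h => by simp [h] at hc
  have hne := ascPochhammer_ne_zero_of_re_pos hc1
  have h := (hasSum_trigammaTerm hc).add
    ((summable_hypergeometricTerm hc1).hasSum.mul_left ((c - 1) / c))
  rw [hypergeometric, hypergeometric, ← h.tsum_eq]
  refine tsum_congr fun l => ?_
  have h5 := ascPochhammer_ne_zero_of_re_pos hc l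
  have h1 := ascPochhammer_ne_zero_of_re_pos hc (l + 1)
  have h3 : (l : ℂ) + 1 ≠ 0 := by exact_mod_cast l.succ_ne_zero
  have h6 : (ascPochhammer ℂ l).eval c * (c + l) = c * (ascPochhammer ℂ l).eval (c + 1) := by
    rw [← ascPochhammer_eval_succ_left, ascPochhammer_succ_eval]
  rw [ascPochhammer_succ_eval] at h1
  have h4 := right_ne_zero_of_mul h1
  have h7 := hne l
  have h8 : (ascPochhammer ℂ l).eval (c + 1) = (ascPochhammer ℂ l).eval c * (c + l) / c := by
    field_simp
    linear_combination -h6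
  rw [hypergeometricTerm_eq, hypergeometricTerm_eq, ascPochhammer_succ_eval, h8]
  field_simp
  ring

/-- Divided by c-1, the recurrence expresses each summand as a difference of consecutive values of
F(c)/(c-1). The remainder vanishes because F(c+N) stays bounded. -/
theorem tendsto_sum_polygamma_one_div {c : ℂ} (hc : 1 < c.re) :
    Tendsto (fun N : ℕ => ∑ j ∈ Finset.range N, polygamma 1 (c + j) / (c + j - 1)) atTop
      (𝓝 (hypergeometric {1, 1, 1, 1} {2, 2, c} 1 / (c - 1))) := by
  have hne (j : ℕ) : c + j ≠ 0 ∧ c + j - 1 ≠ 0 := by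
    have h1 : 0 < (c + j - 1).re := by simp; linarith [(Nat.cast_nonneg j : (0:ℝ) ≤ j)]
    have h2 : 0 < (c + j).re := by simp; linarith [(Nat.cast_nonneg j : (0:ℝ) ≤ j)]
    exact ⟨fun h => by simp [h] at h2, fun h => by simp [h] at h1⟩
  have hsum (N : ℕ) : ∑ j ∈ Finset.range N, polygamma 1 (c + j) / (c + j - 1) =
      hypergeometric {1, 1, 1, 1} {2, 2, c} 1 / (c - 1) -
        hypergeometric {1, 1, 1, 1} {2, 2, c + N} 1 / (c + N - 1) := by
    induction N with
    | zero => simp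
    | succ N ih =>
      have h1 : 0 < (c + N).re := by simp; linarith [(Nat.cast_nonneg N : (0:ℝ) ≤ N)]
      rw [Finset.sum_range_succ, ih, hypergeometric_add_one h1]
      obtain ⟨h2, h3⟩ := hne N
      push_cast
      rw [← add_assoc, add_sub_cancel_right]
      field_simp
      ring
  have hc0 : 0 < c.re := by linarith
  have hlim : Tendsto (fun N : ℕ => hypergeometric {1, 1, 1, 1} {2, 2, c + N} 1 / (c + N - 1))
      atTop (𝓝 0) := by
    have h0 : Tendsto (fun N : ℕ => (∑' l : ℕ, (l.factorial : ℝ) /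
        (((l : ℝ) + 1) ^ 2 * (ascPochhammer ℝ l).eval c.re)) / (c.re - 1 + N)) atTop (𝓝 0) :=
      tendsto_const_nhds.div_atTop
        (tendsto_atTop_add_const_left _ _ tendsto_natCast_atTop_atTop)
    refine squeeze_zero_norm (fun N => ?_) h0
    have h1 := norm_hypergeometric_le hc0 (c := c + N) (by simp)
    have h2 := norm_add_natCast_ge (s := c - 1) (b := c.re - 1) (by simp) N
    have h3 : 0 < c.re - 1 + N := by linarith [(Nat.cast_nonneg N : (0:ℝ) ≤ N)]
    rw [norm_div, show c + N - 1 = c - 1 + N by ring]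
    gcongr
    exact (norm_nonneg _).trans h1
  have h2 := hlim.const_sub (hypergeometric {1, 1, 1, 1} {2, 2, c} 1 / (c - 1))
  rw [sub_zero] at h2
  exact h2.congr fun N => (hsum N).symm

/-! ### Double sums over shifted lattices. -/

section DoubleSums

theorem HasSum.congr_of_eq {ι α : Type*} [AddCommMonoid α] [TopologicalSpace α] {f g : ι → α}
    {a b : α} (h : HasSum f a) (hfg : ∀ i, g i = f i) (hab : b = a) : HasSum g b := by
  rw [hab, show g = f from funext hfg]
  exact h

theorem hasSum_antidiagonal_of_summable {f : ℕ × ℕ → ℝ} (hf : Summable f) :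
    HasSum (fun n => ∑ p ∈ Finset.HasAntidiagonal.antidiagonal n, f p) (∑' p, f p) := by
  have h := (Finset.HasAntidiagonal.sigmaAntidiagonalEquivProd (A := ℕ)).hasSum_iff.2 hf.hasSum
  refine (h.sigma fun n => hasSum_fintype _).congr_fun fun n => ?_
  rw [← Finset.sum_coe_sort]
  rfl

/-- Partial fractions telescope with gap m, leaving the first m reciprocals and a tail of m terms
tending to 0. -/
theorem hasSum_inv_mul_inv_add {a : ℝ} (ha : 0 < a) {m : ℕ} (hm : 0 < m) :
    HasSum (fun k : ℕ => 1 / (((k : ℝ) + a) * ((k : ℝ) + a + m)))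
      (1 / m * ∑ i ∈ Finset.range m, 1 / ((i : ℝ) + a)) := by
  have hm' : (0 : ℝ) < m := by exact_mod_cast hm
  rw [hasSum_iff_tendsto_nat_of_nonneg fun k => by positivity]
  have hsum (N : ℕ) : ∑ k ∈ Finset.range N, 1 / (((k : ℝ) + a) * ((k : ℝ) + a + m)) =
      1 / m * (∑ i ∈ Finset.range m, 1 / ((i : ℝ) + a) -
        ∑ i ∈ Finset.range m, 1 / ((N : ℝ) + (i + a))) := by
    have h1 : ∑ k ∈ Finset.range N, 1 / (((k : ℝ) + a) * ((k : ℝ) + a + m)) =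
        1 / m * (∑ k ∈ Finset.range N, 1 / ((k : ℝ) + a) -
          ∑ k ∈ Finset.range N, 1 / (((m + k : ℕ) : ℝ) + a)) := by
      rw [← Finset.sum_sub_distrib, Finset.mul_sum]
      refine Finset.sum_congr rfl fun k _ => ?_
      push_cast
      field_simp
      ring
    have h2 := Finset.sum_range_add (fun k : ℕ => 1 / ((k : ℝ) + a)) m N
    have h3 := Finset.sum_range_add (fun k : ℕ => 1 / ((k : ℝ) + a)) N m
    rw [add_comm N m] at h3
    rw [h1]
    congr 1
    have h4 : ∑ i ∈ Finset.range m, 1 / ((N : ℝ) + (i + a)) =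
        ∑ i ∈ Finset.range m, 1 / (((N + i : ℕ) : ℝ) + a) :=
      Finset.sum_congr rfl fun i _ => by push_cast; rw [add_assoc]
    rw [h4]
    linarith
  have hlim : Tendsto (fun N : ℕ => ∑ i ∈ Finset.range m, 1 / ((N : ℝ) + (i + a))) atTop
      (𝓝 (∑ i ∈ Finset.range m, 0)) :=
    tendsto_finsetSum _ fun i _ => tendsto_const_nhds.div_atTop
      (tendsto_atTop_add_const_right _ _ tendsto_natCast_atTop_atTop)
  rw [Finset.sum_const_zero] at hlim
  have h := (hlim.const_sub (∑ i ∈ Finset.range m, 1 / ((i : ℝ) + a))).const_mul (1 / (m : ℝ))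
  rw [sub_zero] at h
  exact h.congr fun N => (hsum N).symm

theorem summable_inv_mul_sqrt {a : ℝ} (ha : 0 < a) :
    Summable fun k : ℕ => 1 / (((k : ℝ) + a) * √((k : ℝ) + a)) := by
  have h := (Real.summable_one_div_nat_add_rpow a (3 / 2)).2 (by norm_num)
  refine h.congr fun k => ?_
  have hk : 0 < (k : ℝ) + a := by positivity
  rw [abs_of_pos hk, Real.sqrt_eq_rpow]
  nth_rewrite 2 [← Real.rpow_one ((k : ℝ) + a)]
  rw [← Real.rpow_add hk]
  norm_num

/-- From x+y ≥ √x √y, the term is at most x^(-3/2) y^(-3/2), a product of convergent series. -/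
theorem summable_inv_mul_mul_add {a b : ℝ} (ha : 0 < a) (hb : 0 < b) :
    Summable fun p : ℕ × ℕ =>
      1 / (((p.1 : ℝ) + a) * ((p.2 : ℝ) + b) * (((p.1 : ℝ) + a) + ((p.2 : ℝ) + b))) := by
  refine Summable.of_nonneg_of_le (fun p => by positivity) (fun p => ?_)
    ((summable_inv_mul_sqrt ha).mul_of_nonneg (summable_inv_mul_sqrt hb)
      (fun k => by positivity) (fun k => by positivity))
  have hx : 0 < (p.1 : ℝ) + a := by positivity
  have hy : 0 < (p.2 : ℝ) + b := by positivity
  set x := (p.1 : ℝ) + a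
  set y := (p.2 : ℝ) + b
  have h : √x * √y ≤ x + y := by
    nlinarith [Real.sq_sqrt hx.le, Real.sq_sqrt hy.le, sq_nonneg (√x - √y),
      mul_nonneg (Real.sqrt_nonneg x) (Real.sqrt_nonneg y)]
  rw [one_div_mul_one_div, show x * √x * (y * √y) = x * y * (√x * √y) by ring]
  gcongr

theorem inv_mul_mul_add_eq {x y : ℝ} (hx : 0 < x) (hy : 0 < y) :
    1 / (x * y * (x + y)) = 1 / (x * (x + y) ^ 2) + 1 / (y * (x + y) ^ 2) := by
  field_simp
  ring

theorem summable_inv_mul_add_sq {a b : ℝ} (ha : 0 < a) (hb : 0 < b) :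
    Summable fun p : ℕ × ℕ =>
      1 / (((p.1 : ℝ) + a) * (((p.1 : ℝ) + a) + ((p.2 : ℝ) + b)) ^ 2) := by
  refine Summable.of_nonneg_of_le (fun p => by positivity) (fun p => ?_)
    (summable_inv_mul_mul_add ha hb)
  rw [inv_mul_mul_add_eq (by positivity) (by positivity)]
  exact le_add_of_nonneg_right (by positivity)

/-- Grouping by antidiagonals makes x+y constant. -/
theorem hasSum_inv_mul_add_sq {a b : ℝ} (ha : 0 < a) (hb : 0 < b) :
    HasSum (fun n : ℕ => 1 / ((n : ℝ) + (a + b)) ^ 2 *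
        ∑ i ∈ Finset.range (n + 1), 1 / ((i : ℝ) + a))
      (∑' p : ℕ × ℕ, 1 / (((p.1 : ℝ) + a) * (((p.1 : ℝ) + a) + ((p.2 : ℝ) + b)) ^ 2)) := by
  refine (hasSum_antidiagonal_of_summable (summable_inv_mul_add_sq ha hb)).congr_fun fun n => ?_
  rw [Finset.Nat.sum_antidiagonal_eq_sum_range_succ
    (fun i j : ℕ => 1 / (((i : ℝ) + a) * (((i : ℝ) + a) + ((j : ℝ) + b)) ^ 2)), Finset.mul_sum]
  refine Finset.sum_congr rfl fun i hi => ?_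
  rw [Nat.cast_sub (Nat.lt_succ_iff.1 (Finset.mem_range.1 hi)), one_div_mul_one_div, mul_comm]
  congr 3
  ring

/-- This is the series for ψ at 1/2, combined with ψ(1/2) = -γ - 2 log 2. -/
theorem hasSum_inv_half_sub_inv_one :
    HasSum (fun k : ℕ => 1 / ((k : ℝ) + 1 / 2) - 1 / ((k : ℝ) + 1)) (2 * Real.log 2) := by
  rw [← Complex.hasSum_ofReal]
  have h := (summable_digamma_series (s := 1 / 2) (by norm_num)).hasSum.neg
  have h1 := digamma_eq_tsum (s := 1 / 2) (by norm_num)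
  rw [Complex.digamma_one_half] at h1
  refine h.congr_of_eq (fun k => ?_) ?_
  · push_cast
    rw [add_comm (1 / 2 : ℂ)]
    ring
  · push_cast
    rw [← Complex.ofReal_ofNat, ← Complex.ofReal_log (by norm_num), Complex.ofReal_ofNat] at h1
    linear_combination -h1

/-- Partial sums of `∑ 1 / (i + 1/2)`. -/
noncomputable def oddHarmonic (n : ℕ) : ℝ := ∑ i ∈ Finset.range n, 1 / ((i : ℝ) + 1 / 2)

/-- Partial sums of `∑ 1 / (i + 1)`. -/
noncomputable def realHarmonic (n : ℕ) : ℝ := ∑ i ∈ Finset.range n, 1 / ((i : ℝ) + 1)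

/-- After partial fractions the two progressions differ by a half-integer; inserting 1/(r+1/2)
splits this into an integer gap and the log 2 series. -/
theorem hasSum_inv_one_mul (j : ℕ) :
    HasSum (fun r : ℕ => 1 / (((r : ℝ) + 1) * (((j : ℝ) + 1 / 2) + ((r : ℝ) + 1))))
      (1 / ((j : ℝ) + 1 / 2) * (oddHarmonic (j + 1) - 2 * Real.log 2)) := by
  have h1 := (hasSum_inv_mul_inv_add (by norm_num : (0 : ℝ) < 1 / 2) j.succ_pos).mul_left
    ((j : ℝ) + 1)
  have h2 := (h1.sub hasSum_inv_half_sub_inv_one).mul_left (1 / ((j : ℝ) + 1 / 2))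
  refine h2.congr_of_eq (fun r => ?_) ?_
  · push_cast
    field_simp
    ring
  · rw [oddHarmonic]
    push_cast
    field_simp

theorem hasSum_inv_half_mul (j : ℕ) :
    HasSum (fun i : ℕ => 1 / (((i : ℝ) + 1 / 2) * (((i : ℝ) + 1 / 2) + ((j : ℝ) + 1 / 2))))
      (1 / ((j : ℝ) + 1 / 2) * (2 * Real.log 2 + realHarmonic j)) := by
  have h1 : HasSum (fun k : ℕ => 1 / ((k : ℝ) + 1) - 1 / ((k : ℝ) + 1 + j)) (realHarmonic j) := by
    rcases Nat.eq_zero_or_pos j with rfl | hj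
    · simp [realHarmonic, hasSum_zero]
    · have hj' : (0 : ℝ) < j := by exact_mod_cast hj
      refine ((hasSum_inv_mul_inv_add one_pos hj).mul_left (j : ℝ)).congr_of_eq (fun k => ?_) ?_
      · field_simp
        ring
      · rw [realHarmonic]
        field_simp
  have h2 := (hasSum_inv_half_sub_inv_one.add h1).mul_left (1 / ((j : ℝ) + 1 / 2))
  refine h2.congr_fun fun r => ?_
  have : (r : ℝ) + 1 / 2 + (j + 1 / 2) = r + 1 + j := by ring
  rw [this]
  field_simp
  ring

/-- The sum `∑ 1 / (x (x + y)²)` over `x ∈ ℕ + 1/2`, `y ∈ ℕ + 1`. -/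
theorem tsum_inv_half_mul_add_sq :
    ∑' p : ℕ × ℕ, 1 / (((p.1 : ℝ) + 1 / 2) * (((p.1 : ℝ) + 1 / 2) + ((p.2 : ℝ) + 1)) ^ 2) =
      π ^ 2 * Real.log 2 - 7 / 2 * ∑' n : ℕ, 1 / (n : ℝ) ^ 3 := by
  have h0 : (0 : ℝ) < 1 / 2 := by norm_num
  have sA := summable_inv_mul_mul_add h0 one_pos
  have sB := summable_inv_mul_mul_add h0 h0
  have sA1 := summable_inv_mul_add_sq h0 one_pos
  have sA2 := summable_inv_mul_add_sq one_pos h0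
  have sB1 := summable_inv_mul_add_sq h0 h0
  have hA1 := hasSum_inv_mul_add_sq h0 one_pos
  have hA2 := hasSum_inv_mul_add_sq one_pos h0
  have hB1 := hasSum_inv_mul_add_sq h0 h0
  set A := ∑' p : ℕ × ℕ, 1 / (((p.1 : ℝ) + 1 / 2) * ((p.2 : ℝ) + 1) *
    (((p.1 : ℝ) + 1 / 2) + ((p.2 : ℝ) + 1))) with hA
  set B := ∑' p : ℕ × ℕ, 1 / (((p.1 : ℝ) + 1 / 2) * ((p.2 : ℝ) + 1 / 2) *
    (((p.1 : ℝ) + 1 / 2) + ((p.2 : ℝ) + 1 / 2))) with hB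
  set A1 := ∑' p : ℕ × ℕ,
    1 / (((p.1 : ℝ) + 1 / 2) * (((p.1 : ℝ) + 1 / 2) + ((p.2 : ℝ) + 1)) ^ 2)
  set A2 := ∑' p : ℕ × ℕ,
    1 / (((p.1 : ℝ) + 1) * (((p.1 : ℝ) + 1) + ((p.2 : ℝ) + 1 / 2)) ^ 2) with hA2_def
  set B1 := ∑' p : ℕ × ℕ,
    1 / (((p.1 : ℝ) + 1 / 2) * (((p.1 : ℝ) + 1 / 2) + ((p.2 : ℝ) + 1 / 2)) ^ 2) with hB1_def
  have e1 : A = A1 + A2 := by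
    have h := sA1.hasSum.add ((Equiv.prodComm ℕ ℕ).hasSum_iff.2 sA2.hasSum)
    refine (h.congr_fun fun p => ?_).tsum_eq
    rw [inv_mul_mul_add_eq (by positivity) (by positivity)]
    simp only [Function.comp_apply, Equiv.prodComm_apply, Prod.fst_swap, Prod.snd_swap]
    rw [add_comm ((p.2 : ℝ) + 1)]
  have e2 : B = B1 + B1 := by
    have h := sB1.hasSum.add ((Equiv.prodComm ℕ ℕ).hasSum_iff.2 sB1.hasSum)
    refine (h.congr_fun fun p => ?_).tsum_eq
    rw [inv_mul_mul_add_eq (by positivity) (by positivity)]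
    simp only [Function.comp_apply, Equiv.prodComm_apply, Prod.fst_swap, Prod.snd_swap]
    rw [add_comm ((p.2 : ℝ) + 1 / 2)]
  -- Summing A over its half-integer variable first gives the same single series as summing B1 along
  -- antidiagonals.
  have e3 : A = B1 := by
    have h := ((Equiv.prodComm ℕ ℕ).hasSum_iff.2 sA.hasSum).prod_fiberwise
      (fun r => ((hasSum_inv_mul_inv_add h0 r.succ_pos).mul_left (1 / ((r : ℝ) + 1))).congr_fun
        fun j => ?_)
    · refine h.unique (hB1.congr_fun fun n => ?_)
      rw [← mul_assoc, add_halves]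
      push_cast
      rw [one_div_mul_one_div, sq]
    · simp only [Function.comp_apply, Equiv.prodComm_apply, Prod.swap_prod_mk]
      push_cast
      field_simp
  -- The index shift is harmless: the harmonic factor is an empty sum at n = 0.
  have hA1' : HasSum (fun n : ℕ => 1 / ((n : ℝ) + 1 / 2) ^ 2 * oddHarmonic n) A1 := by
    rw [← hasSum_nat_add_iff' 1]
    simp only [Finset.sum_range_one, oddHarmonic, Finset.range_zero, Finset.sum_empty, mul_zero,
      sub_zero]
    refine hA1.congr_fun fun n => ?_
    push_cast
    ring
  have hA2' : HasSum (fun n : ℕ => 1 / ((n : ℝ) + 1 / 2) ^ 2 * realHarmonic n) A2 := by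
    rw [← hasSum_nat_add_iff' 1]
    simp only [Finset.sum_range_one, realHarmonic, Finset.range_zero, Finset.sum_empty, mul_zero,
      sub_zero]
    refine hA2.congr_fun fun n => ?_
    push_cast
    ring
  -- Summing A over its integer variable first. The last term of `oddHarmonic (n + 1)` supplies the
  -- cubes, hence 7ζ(3).
  have e4 : A = A1 + 7 * ∑' n : ℕ, 1 / (n : ℝ) ^ 3 - 2 * Real.log 2 * (π ^ 2 / 2) := by
    have h := sA.hasSum.prod_fiberwise
      (fun j => ((hasSum_inv_one_mul j).mul_left (1 / ((j : ℝ) + 1 / 2))).congr_fun fun r => ?_)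
    · refine h.unique (((hA1'.add hasSum_one_div_half_add_cube).sub
        (hasSum_one_div_half_add_sq.mul_left (2 * Real.log 2))).congr_fun fun n => ?_)
      rw [oddHarmonic, Finset.sum_range_succ, ← oddHarmonic]
      field_simp
    · field_simp
  have e5 : B = 2 * Real.log 2 * (π ^ 2 / 2) + A2 := by
    have h := ((Equiv.prodComm ℕ ℕ).hasSum_iff.2 sB.hasSum).prod_fiberwise
      (fun j => ((hasSum_inv_half_mul j).mul_left (1 / ((j : ℝ) + 1 / 2))).congr_fun fun r => ?_)
    · refine h.unique (((hasSum_one_div_half_add_sq.mul_left (2 * Real.log 2)).add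
        hA2').congr_fun fun n => ?_)
      field_simp
    · simp only [Function.comp_apply, Equiv.prodComm_apply, Prod.swap_prod_mk]
      field_simp
  -- `e1` and `e4` give A2 = 7ζ(3) - π² log 2; `e2` and `e3` give B = 2A, so `e5` gives A = 7ζ(3)/2;
  -- then A1 = A - A2.
  linarith

end DoubleSums

/-! ### The value at 3/2. -/

/-- The value `4F3(1, 1, 1, 1; 2, 2, 3/2; 1)`. -/
theorem hypergeometric_three_halves :
    hypergeometric {1, 1, 1, 1} {2, 2, 3 / 2} 1 =
      -(7 / 4) * riemannZeta 3 + (π : ℂ) ^ 2 / 2 * (Real.log 2 : ℂ) := by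
  have h1 := tendsto_sum_polygamma_one_div (c := 3 / 2) (by norm_num)
  have hs := summable_inv_mul_add_sq (by norm_num : (0 : ℝ) < 1 / 2) one_pos
  have h2 := (Complex.hasSum_ofReal.2 hs.hasSum).prod_fiberwise
    (g := fun j : ℕ => polygamma 1 (3 / 2 + j) / (3 / 2 + j - 1)) (fun j => by
      have hre : 0 < (3 / 2 + (j : ℂ)).re := by
        norm_num
        positivity
      rw [polygamma_one_eq_tsum hre]
      have h3 := (summable_one_div_complex_add_pow hre le_rfl).hasSum.mul_right (1 / (3 / 2 + (j : ℂ) - 1))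
      refine h3.congr_of_eq (fun r => ?_) (div_eq_mul_one_div _ _)
      push_cast
      rw [one_div_mul_one_div]
      ring)
  have h4 := tendsto_nhds_unique h1 h2.tendsto_sum_nat
  rw [tsum_inv_half_mul_add_sq] at h4
  rw [riemannZeta_three_eq]
  have h5 : (3 / 2 - 1 : ℂ) = 1 / 2 := by norm_num
  rw [h5, div_eq_iff (by norm_num)] at h4
  rw [h4]
  push_cast
  ring

/-! ### Analytic continuation. -/

/-- The continuation of `4F3(1, 1, 1, 1; 2, 2, c; 1)` to `-N < Re c`, obtained by iterating
`hypergeometric_add_one`. -/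
noncomputable def continuationAux : ℕ → ℂ → ℂ
  | 0, c => hypergeometric {1, 1, 1, 1} {2, 2, c} 1
  | N + 1, c => polygamma 1 c + (c - 1) / c * continuationAux N (c + 1)

theorem differentiableOn_continuationAux (N : ℕ) :
    DifferentiableOn ℂ (continuationAux N) (polygammaDomain ∩ {c : ℂ | -(N : ℝ) < c.re}) := by
  induction N with
  | zero =>
    refine differentiableOn_hypergeometric.mono fun c hc => ?_
    simpa using hc.2
  | succ N ih =>
    have h1 : DifferentiableOn ℂ (fun c => continuationAux N (c + 1))
        (polygammaDomain ∩ {c : ℂ | -((N + 1 : ℕ) : ℝ) < c.re}) := by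
      refine ih.comp (g := continuationAux N) (f := fun c : ℂ => c + 1)
        (differentiableOn_id.add_const 1) fun c hc => ⟨add_one_mem_polygammaDomain hc.1, ?_⟩
      have h := hc.2
      simp only [Set.mem_ofPred_eq, Nat.cast_succ, Complex.add_re, Complex.one_re] at h ⊢
      linarith
    have h2 : DifferentiableOn ℂ (fun c : ℂ => (c - 1) / c)
        (polygammaDomain ∩ {c : ℂ | -((N + 1 : ℕ) : ℝ) < c.re}) :=
      (differentiableOn_id.sub_const 1).div differentiableOn_id
        fun c hc => ne_zero_of_mem_polygammaDomain hc.1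
    exact (differentiableOn_polygamma_one.mono Set.inter_subset_left).add (h2.mul h1)

theorem continuationAux_succ {N : ℕ} {c : ℂ} (hc : -(N : ℝ) < c.re) :
    continuationAux (N + 1) c = continuationAux N c := by
  induction N generalizing c with
  | zero =>
    exact (hypergeometric_add_one (by simpa using hc)).symm
  | succ N ih =>
    rw [continuationAux, ih (by simp at hc ⊢; linarith), ← continuationAux]

theorem continuationAux_of_le {M N : ℕ} (h : N ≤ M) {c : ℂ} (hc : -(N : ℝ) < c.re) :
    continuationAux M c = continuationAux N c := by
  induction M, h using Nat.le_induction with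
  | base => rfl
  | succ M hNM ih =>
    have : (N : ℝ) ≤ M := by exact_mod_cast hNM
    rw [continuationAux_succ (by linarith), ih]

theorem neg_floor_abs_succ_lt (c : ℂ) : -((⌊|c.re|⌋₊ + 1 : ℕ) : ℝ) < c.re := by
  have h1 := Nat.lt_floor_add_one |c.re|
  have h2 := neg_abs_le c.re
  push_cast
  linarith

theorem exists_isContinuationOf4F3 : ∃ G : ℂ → ℂ, IsContinuationOf4F3 G := by
  -- The depth varies with c, but any two sufficient depths agree, so near each point the function
  -- equals one of fixed depth.
  refine ⟨fun c => continuationAux (⌊|c.re|⌋₊ + 1) c, fun c hc => ?_, fun c hc => ?_⟩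
  · set N := ⌊|c.re|⌋₊ + 1
    have hopen : IsOpen (polygammaDomain ∩ {c : ℂ | -(N : ℝ) < c.re}) :=
      isOpen_polygammaDomain.inter (isOpen_lt continuous_const Complex.continuous_re)
    have hmem := hopen.mem_nhds ⟨hc, neg_floor_abs_succ_lt c⟩
    refine (((differentiableOn_continuationAux N).differentiableAt hmem).congr_of_eventuallyEq
      ?_).differentiableWithinAt
    filter_upwards [hmem] with z hz
    rw [← continuationAux_of_le (le_max_left _ N) (neg_floor_abs_succ_lt z),
      continuationAux_of_le (le_max_right _ N) hz.2]
  · exact continuationAux_of_le (Nat.zero_le _) (by simpa using hc)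

/-- Both sides are analytic on the connected domain and agree near 1 by the recurrence for the
series. -/
theorem IsContinuationOf4F3.add_one {G : ℂ → ℂ} (hG : IsContinuationOf4F3 G) {c : ℂ}
    (hc : c ∈ polygammaDomain) : G c = polygamma 1 c + (c - 1) / c * G (c + 1) := by
  have h1 : AnalyticOnNhd ℂ G polygammaDomain :=
    hG.holomorphic.analyticOnNhd isOpen_polygammaDomain
  have h2 : AnalyticOnNhd ℂ (fun c => polygamma 1 c + (c - 1) / c * G (c + 1))
      polygammaDomain := by
    refine DifferentiableOn.analyticOnNhd ?_ isOpen_polygammaDomain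
    have h3 : DifferentiableOn ℂ (fun c => G (c + 1)) polygammaDomain :=
      hG.holomorphic.comp (g := G) (f := fun c : ℂ => c + 1)
        (differentiableOn_id.add_const 1) fun c hc => add_one_mem_polygammaDomain hc
    have h4 : DifferentiableOn ℂ (fun c : ℂ => (c - 1) / c) polygammaDomain :=
      (differentiableOn_id.sub_const 1).div differentiableOn_id
        fun c hc => ne_zero_of_mem_polygammaDomain hc
    exact differentiableOn_polygamma_one.add (h4.mul h3)
  refine h1.eqOn_of_preconnected_of_eventuallyEq h2 isPreconnected_polygammaDomain
    (z₀ := 1) (mem_polygammaDomain_of_re_pos (by simp)) ?_ hc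
  filter_upwards [(isOpen_lt continuous_const Complex.continuous_re).mem_nhds
    (show (0 : ℝ) < (1 : ℂ).re by simp)] with z hz
  have hz' : 0 < z.re := hz
  rw [hG.eq_series z hz', hG.eq_series (z + 1) (by simp; linarith), hypergeometric_add_one hz']

/-! ### How the finite sums change with n. -/

section FiniteSums

theorem natCast_add_half_ne_zero (n : ℕ) : (n : ℂ) + 1 / 2 ≠ 0 := by
  intro h
  have h1 := congrArg Complex.re h
  norm_num at h1
  linarith [(Nat.cast_nonneg n : (0 : ℝ) ≤ n)]

theorem natCast_sub_add_half_ne_zero (l n : ℕ) : (l : ℂ) - n + 1 / 2 ≠ 0 := by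
  intro h
  have h1 : ((2 * (l - n) + 1 : ℤ) : ℂ) = 0 := by
    push_cast
    linear_combination 2 * h
  have h2 : (2 * (l - n) + 1 : ℤ) = 0 := by exact_mod_cast h1
  omega

/-- The reflection l ↦ n-1-l turns l-n+1/2 into -(l+1/2). -/
theorem sum_range_inv_sub_add_half_pow (n m : ℕ) :
    ∑ l ∈ Finset.range n, 1 / ((l : ℂ) - n + 1 / 2) ^ m =
      (-1) ^ m * ∑ l ∈ Finset.range n, 1 / ((l : ℂ) + 1 / 2) ^ m := by
  rw [← Finset.sum_range_reflect, Finset.mul_sum]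
  refine Finset.sum_congr rfl fun l hl => ?_
  have hl' : l + 1 ≤ n := Finset.mem_range.1 hl
  have h : (((n - 1 - l : ℕ) : ℂ) - n + 1 / 2) = (-1) * ((l : ℂ) + 1 / 2) := by
    rw [Nat.sub_sub, add_comm 1 l, Nat.cast_sub hl']
    push_cast
    ring
  rw [h, mul_pow, one_div, mul_inv, ← inv_pow, one_div]
  norm_num

variable {a b : ℕ → ℂ}

/-- Shifting l and n together fixes d = l-n+1/2, and the recurrences of a and b produce a rational
correction. As n+1/2 = (l+1) - d, partial fractions split it into sums of 1/d² and 1/(l+1)²; the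
latter cancels against b n. The application is a l = ψ(1+l), b l = ψ'(1+l). -/
theorem sum_range_shift_first (ha : ∀ l, a (l + 1) = a l + 1 / ((l : ℂ) + 1))
    (hb : ∀ l, b (l + 1) = b l - 1 / ((l : ℂ) + 1) ^ 2) (n : ℕ) :
    ∑ l ∈ Finset.range (n + 1), (a l / ((l : ℂ) - (n + 1 : ℕ) + 1 / 2) ^ 2 -
        b l * (1 / ((l : ℂ) + 1 / 2) + 1 / ((l : ℂ) - (n + 1 : ℕ) + 1 / 2))) =
      ∑ l ∈ Finset.range n, (a l / ((l : ℂ) - n + 1 / 2) ^ 2 -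
        b l * (1 / ((l : ℂ) + 1 / 2) + 1 / ((l : ℂ) - n + 1 / 2))) +
      a 0 / ((n : ℂ) + 1 / 2) ^ 2 +
      1 / ((n : ℂ) + 1 / 2) * ∑ l ∈ Finset.range n, 1 / ((l : ℂ) + 1 / 2) ^ 2 := by
  have hs := natCast_add_half_ne_zero n
  have hbn : b n = b 0 - ∑ l ∈ Finset.range n, 1 / ((l : ℂ) + 1) ^ 2 := by
    clear hs
    induction n with
    | zero => simp
    | succ n ih =>
      rw [hb, ih, Finset.sum_range_succ]
      ring
  have h1 : ∑ l ∈ Finset.range (n + 1), (a l / ((l : ℂ) - (n + 1 : ℕ) + 1 / 2) ^ 2 -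
        b l * (1 / ((l : ℂ) + 1 / 2) + 1 / ((l : ℂ) - (n + 1 : ℕ) + 1 / 2))) =
      ∑ l ∈ Finset.range (n + 1), (a l / ((l : ℂ) - (n + 1 : ℕ) + 1 / 2) ^ 2 -
        b l * (1 / ((l : ℂ) - (n + 1 : ℕ) + 1 / 2))) -
      ∑ l ∈ Finset.range (n + 1), b l * (1 / ((l : ℂ) + 1 / 2)) := by
    rw [← Finset.sum_sub_distrib]
    exact Finset.sum_congr rfl fun l _ => by ring
  have h2 : ∑ l ∈ Finset.range n, (a (l + 1) / (((l + 1 : ℕ) : ℂ) - (n + 1 : ℕ) + 1 / 2) ^ 2 -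
        b (l + 1) * (1 / (((l + 1 : ℕ) : ℂ) - (n + 1 : ℕ) + 1 / 2))) =
      ∑ l ∈ Finset.range n, ((a l / ((l : ℂ) - n + 1 / 2) ^ 2 -
        b l * (1 / ((l : ℂ) + 1 / 2) + 1 / ((l : ℂ) - n + 1 / 2))) +
        b l * (1 / ((l : ℂ) + 1 / 2)) +
        1 / ((n : ℂ) + 1 / 2) * (1 / ((l : ℂ) - n + 1 / 2) ^ 2) -
        1 / ((n : ℂ) + 1 / 2) * (1 / ((l : ℂ) + 1) ^ 2)) := by
    refine Finset.sum_congr rfl fun l _ => ?_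
    have hd := natCast_sub_add_half_ne_zero l n
    have hl : (l : ℂ) + 1 ≠ 0 := by exact_mod_cast l.succ_ne_zero
    have key : 1 / (((l : ℂ) + 1) * ((l : ℂ) - n + 1 / 2) ^ 2) +
        1 / (((l : ℂ) + 1) ^ 2 * ((l : ℂ) - n + 1 / 2)) =
        1 / ((n : ℂ) + 1 / 2) * (1 / ((l : ℂ) - n + 1 / 2) ^ 2) -
        1 / ((n : ℂ) + 1 / 2) * (1 / ((l : ℂ) + 1) ^ 2) := by
      have hsd : (n : ℂ) + 1 / 2 = (l + 1) - ((l : ℂ) - n + 1 / 2) := by ring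
      generalize (l : ℂ) - n + 1 / 2 = d at hd hsd
      rw [hsd] at hs ⊢
      field_simp
      ring
    have e : ((l + 1 : ℕ) : ℂ) - (n + 1 : ℕ) + 1 / 2 = (l : ℂ) - n + 1 / 2 := by
      push_cast
      ring
    have k1 : 1 / (((l : ℂ) + 1) * ((l : ℂ) - n + 1 / 2) ^ 2) =
      1 / ((l : ℂ) + 1) * (1 / ((l : ℂ) - n + 1 / 2) ^ 2) := by rw [one_div_mul_one_div]
    have k2 : 1 / (((l : ℂ) + 1) ^ 2 * ((l : ℂ) - n + 1 / 2)) =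
      1 / ((l : ℂ) + 1) ^ 2 * (1 / ((l : ℂ) - n + 1 / 2)) := by rw [one_div_mul_one_div]
    rw [e, ha, hb, div_eq_mul_one_div (a l + _), div_eq_mul_one_div (a l)]
    linear_combination key - k1 - k2
  have h3 := sum_range_inv_sub_add_half_pow n 2
  have e0 : ((0 : ℕ) : ℂ) - (n + 1 : ℕ) + 1 / 2 = -((n : ℂ) + 1 / 2) := by
    push_cast
    ring
  rw [h1, Finset.sum_range_succ', Finset.sum_range_succ (fun l => b l * _), h2,
    Finset.sum_sub_distrib, Finset.sum_add_distrib, Finset.sum_add_distrib, ← Finset.mul_sum,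
    ← Finset.mul_sum, h3, e0, hbn, neg_sq, div_neg]
  ring

/-- Here only the part with l-n+1/2 needs reindexing; the rest just gains its term at l = n. The
sums of 1/(l+1) and 1/(l+1)² from partial fractions cancel against a n and b n. -/
theorem sum_range_shift_second (ha : ∀ l, a (l + 1) = a l + 1 / ((l : ℂ) + 1))
    (hb : ∀ l, b (l + 1) = b l - 1 / ((l : ℂ) + 1) ^ 2) (n : ℕ) :
    ∑ l ∈ Finset.range (n + 1), (a l / ((l : ℂ) + 1 / 2) ^ 2 -
        b l * (1 / ((l : ℂ) + 1 / 2) + 1 / ((l : ℂ) - (n + 1 : ℕ) + 1 / 2))) =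
      ∑ l ∈ Finset.range n, (a l / ((l : ℂ) + 1 / 2) ^ 2 -
        b l * (1 / ((l : ℂ) + 1 / 2) + 1 / ((l : ℂ) - n + 1 / 2))) +
      1 / ((n : ℂ) + 1 / 2) ^ 2 *
        (a 0 - ∑ l ∈ Finset.range n, 1 / ((l : ℂ) + 1 / 2)) := by
  have hs := natCast_add_half_ne_zero n
  have hbn : b n = b 0 - ∑ l ∈ Finset.range n, 1 / ((l : ℂ) + 1) ^ 2 := by
    clear hs
    induction n with
    | zero => simp
    | succ n ih =>
      rw [hb, ih, Finset.sum_range_succ]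
      ring
  have han : a n = a 0 + ∑ l ∈ Finset.range n, 1 / ((l : ℂ) + 1) := by
    clear hs hbn
    induction n with
    | zero => simp
    | succ n ih =>
      rw [ha, ih, Finset.sum_range_succ]
      ring
  have h1 : ∑ l ∈ Finset.range (n + 1), (a l / ((l : ℂ) + 1 / 2) ^ 2 -
        b l * (1 / ((l : ℂ) + 1 / 2) + 1 / ((l : ℂ) - (n + 1 : ℕ) + 1 / 2))) =
      ∑ l ∈ Finset.range (n + 1), (a l / ((l : ℂ) + 1 / 2) ^ 2 - b l * (1 / ((l : ℂ) + 1 / 2))) -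
      ∑ l ∈ Finset.range (n + 1), b l * (1 / ((l : ℂ) - (n + 1 : ℕ) + 1 / 2)) := by
    rw [← Finset.sum_sub_distrib]
    exact Finset.sum_congr rfl fun l _ => by ring
  have h1' : ∑ l ∈ Finset.range n, (a l / ((l : ℂ) + 1 / 2) ^ 2 -
        b l * (1 / ((l : ℂ) + 1 / 2) + 1 / ((l : ℂ) - n + 1 / 2))) =
      ∑ l ∈ Finset.range n, (a l / ((l : ℂ) + 1 / 2) ^ 2 - b l * (1 / ((l : ℂ) + 1 / 2))) -
      ∑ l ∈ Finset.range n, b l * (1 / ((l : ℂ) - n + 1 / 2)) := by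
    rw [← Finset.sum_sub_distrib]
    exact Finset.sum_congr rfl fun l _ => by ring
  have h2 : ∑ l ∈ Finset.range n, b (l + 1) * (1 / (((l + 1 : ℕ) : ℂ) - (n + 1 : ℕ) + 1 / 2)) =
      ∑ l ∈ Finset.range n, (b l * (1 / ((l : ℂ) - n + 1 / 2)) -
        1 / ((n : ℂ) + 1 / 2) ^ 2 * (1 / ((l : ℂ) - n + 1 / 2) ^ 1) +
        1 / ((n : ℂ) + 1 / 2) ^ 2 * (1 / ((l : ℂ) + 1)) +
        1 / ((n : ℂ) + 1 / 2) * (1 / ((l : ℂ) + 1) ^ 2)) := by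
    refine Finset.sum_congr rfl fun l _ => ?_
    have hd := natCast_sub_add_half_ne_zero l n
    have hl : (l : ℂ) + 1 ≠ 0 := by exact_mod_cast l.succ_ne_zero
    have key : 1 / ((l : ℂ) + 1) ^ 2 * (1 / ((l : ℂ) - n + 1 / 2)) =
        1 / ((n : ℂ) + 1 / 2) ^ 2 * (1 / ((l : ℂ) - n + 1 / 2) ^ 1) -
        1 / ((n : ℂ) + 1 / 2) ^ 2 * (1 / ((l : ℂ) + 1)) -
        1 / ((n : ℂ) + 1 / 2) * (1 / ((l : ℂ) + 1) ^ 2) := by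
      have hsd : (n : ℂ) + 1 / 2 = (l + 1) - ((l : ℂ) - n + 1 / 2) := by ring
      generalize (l : ℂ) - n + 1 / 2 = d at hd hsd
      rw [hsd] at hs ⊢
      field_simp
    have e : ((l + 1 : ℕ) : ℂ) - (n + 1 : ℕ) + 1 / 2 = (l : ℂ) - n + 1 / 2 := by
      push_cast
      ring
    rw [e, hb]
    linear_combination -key
  have h3 := sum_range_inv_sub_add_half_pow n 1
  simp only [pow_one ((_ : ℂ) + 1 / 2), pow_one (-1 : ℂ)] at h3 h2
  have e0 : ((0 : ℕ) : ℂ) - (n + 1 : ℕ) + 1 / 2 = -((n : ℂ) + 1 / 2) := by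
    push_cast
    ring
  have h5 := Finset.sum_range_succ'
    (fun l : ℕ => b l * (1 / ((l : ℂ) - (n + 1 : ℕ) + 1 / 2))) n
  have h6 := Finset.sum_range_succ
    (fun l : ℕ => a l / ((l : ℂ) + 1 / 2) ^ 2 - b l * (1 / ((l : ℂ) + 1 / 2))) n
  rw [h1, h1', h5, h6, h2,
    Finset.sum_add_distrib, Finset.sum_add_distrib, Finset.sum_sub_distrib,
    Finset.sum_sub_distrib, ← Finset.mul_sum,
    ← Finset.mul_sum, ← Finset.mul_sum, h3, e0, hbn, han, div_neg]
  ring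

end FiniteSums

/-! ### Polygamma values at integers and half-integers. -/

theorem digamma_one_add_natCast_succ (l : ℕ) :
    Complex.digamma (1 + (l + 1 : ℕ)) = Complex.digamma (1 + l) + 1 / ((l : ℂ) + 1) := by
  have h := Complex.digamma_apply_add_one (1 + l)
    (mem_polygammaDomain_of_re_pos (by simp; positivity))
  rw [Nat.cast_succ, ← add_assoc, h, one_div, add_comm (1 : ℂ)]

theorem polygamma_one_one_add_natCast_succ (l : ℕ) :
    polygamma 1 (1 + (l + 1 : ℕ)) = polygamma 1 (1 + l) - 1 / ((l : ℂ) + 1) ^ 2 := by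
  have h := polygamma_one_add_one (s := 1 + l)
    (mem_polygammaDomain_of_re_pos (by simp; positivity))
  rw [Nat.cast_succ, ← add_assoc, h, add_comm (1 : ℂ)]

theorem half_add_natCast_mem (n : ℕ) : (1 / 2 + (n : ℂ)) ∈ polygammaDomain :=
  mem_polygammaDomain_of_re_pos (by norm_num; positivity)

theorem half_sub_natCast_mem (n : ℕ) : (1 / 2 - (n : ℂ)) ∈ polygammaDomain := by
  intro k h
  apply natCast_sub_add_half_ne_zero k n
  linear_combination h

theorem digamma_half_add_natCast_succ (n : ℕ) :
    Complex.digamma (1 / 2 + (n + 1 : ℕ)) =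
      Complex.digamma (1 / 2 + n) + 1 / ((n : ℂ) + 1 / 2) := by
  rw [Nat.cast_succ, ← add_assoc, Complex.digamma_apply_add_one _ (half_add_natCast_mem n),
    inv_eq_one_div (1 / 2 + (n : ℂ)), add_comm (1 / 2 : ℂ)]

theorem polygamma_one_half_add_natCast_succ (n : ℕ) :
    polygamma 1 (1 / 2 + (n + 1 : ℕ)) = polygamma 1 (1 / 2 + n) - 1 / ((n : ℂ) + 1 / 2) ^ 2 := by
  rw [Nat.cast_succ, ← add_assoc, polygamma_one_add_one (half_add_natCast_mem n),
    add_comm (1 / 2 : ℂ)]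

theorem polygamma_two_half_add_natCast_succ (n : ℕ) :
    polygamma 2 (1 / 2 + (n + 1 : ℕ)) = polygamma 2 (1 / 2 + n) + 2 / ((n : ℂ) + 1 / 2) ^ 3 := by
  rw [Nat.cast_succ, ← add_assoc, polygamma_two_add_one (half_add_natCast_mem n),
    add_comm (1 / 2 : ℂ)]

theorem digamma_half_add_natCast (n : ℕ) :
    Complex.digamma (1 / 2 + n) = -2 * (Real.log 2 : ℂ) - (Real.eulerMascheroniConstant : ℂ) +
      ∑ l ∈ Finset.range n, 1 / ((l : ℂ) + 1 / 2) := by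
  induction n with
  | zero =>
    have h : Complex.log 2 = (Real.log 2 : ℂ) := by
      rw [Complex.ofReal_log (by norm_num), Complex.ofReal_ofNat]
    simp only [Nat.cast_zero, add_zero, Finset.range_zero, Finset.sum_empty]
    rw [Complex.digamma_one_half, h]
  | succ n ih =>
    rw [digamma_half_add_natCast_succ, ih, Finset.sum_range_succ, add_assoc]

theorem polygamma_one_half_add_natCast (n : ℕ) :
    polygamma 1 (1 / 2 + n) = (π : ℂ) ^ 2 / 2 -
      ∑ l ∈ Finset.range n, 1 / ((l : ℂ) + 1 / 2) ^ 2 := by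
  induction n with
  | zero => simpa using polygamma_one_half
  | succ n ih =>
    rw [polygamma_one_half_add_natCast_succ, ih, Finset.sum_range_succ, sub_sub]

/-- The reflection formula at half-integers, by induction: one step changes ψ'(1/2-n) and ψ'(1/2+n)
by opposite amounts. -/
theorem polygamma_one_half_sub_natCast (n : ℕ) :
    polygamma 1 (1 / 2 - n) = (π : ℂ) ^ 2 - polygamma 1 (1 / 2 + n) := by
  induction n with
  | zero =>
    simp only [Nat.cast_zero, sub_zero, add_zero, polygamma_one_half]
    ring
  | succ n ih =>
    have h := polygamma_one_add_one (half_sub_natCast_mem (n + 1))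
    have h1 : (1 / 2 - ((n + 1 : ℕ) : ℂ)) = -((n : ℂ) + 1 / 2) := by
      push_cast
      ring
    rw [show (1 / 2 - ((n + 1 : ℕ) : ℂ)) + 1 = 1 / 2 - n by push_cast; ring, ih] at h
    rw [polygamma_one_half_add_natCast_succ]
    rw [show (1 / 2 - ((n + 1 : ℕ) : ℂ)) ^ 2 = ((n : ℂ) + 1 / 2) ^ 2 by rw [h1, neg_sq]] at h
    linear_combination -h

/-! ### The two inductions and the special values. -/

theorem hypergeometric_three_halves_add (n : ℕ) :
    1 / (1 / 2 + (n : ℂ)) * hypergeometric {1, 1, 1, 1} {2, 2, 3 / 2 + (n : ℂ)} 1 =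
      7 / 2 * riemannZeta 3 + 1 / 2 * polygamma 2 (1 / 2 + n)
        - (π : ℂ) ^ 2 / 2 * Complex.digamma (1 / 2 + n)
        - (Real.eulerMascheroniConstant : ℂ) * polygamma 1 (1 / 2 + n)
        + ∑ l ∈ Finset.range n,
            (Complex.digamma (1 + l) / ((l : ℂ) - n + 1 / 2) ^ 2
              - polygamma 1 (1 + l) *
                  (1 / ((l : ℂ) + 1 / 2) + 1 / ((l : ℂ) - n + 1 / 2))) := by
  induction n with
  | zero =>
    have h := digamma_half_add_natCast 0
    simp only [Nat.cast_zero, add_zero, Finset.range_zero, Finset.sum_empty] at h ⊢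
    rw [hypergeometric_three_halves, polygamma_two_half, polygamma_one_half, h]
    ring
  | succ n ih =>
    have hs := natCast_add_half_ne_zero n
    have hs1 : (n : ℂ) + 3 / 2 ≠ 0 := by
      have := natCast_add_half_ne_zero (n + 1)
      push_cast at this
      rwa [add_assoc, show (1 : ℂ) + 1 / 2 = 3 / 2 by norm_num] at this
    have hF := hypergeometric_add_one (c := 3 / 2 + (n : ℂ)) (by norm_num; positivity)
    have hT := sum_range_shift_first (a := fun l => Complex.digamma (1 + l))
      (b := fun l => polygamma 1 (1 + l)) digamma_one_add_natCast_succ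
      polygamma_one_one_add_natCast_succ n
    have hP := polygamma_one_half_add_natCast n
    have hP1 := polygamma_one_half_add_natCast_succ n
    rw [show (1 / 2 : ℂ) + (n + 1 : ℕ) = 3 / 2 + n by push_cast; ring] at hP1
    have h0 : Complex.digamma (1 + (0 : ℕ)) = -(Real.eulerMascheroniConstant : ℂ) := by
      rw [Nat.cast_zero, add_zero, Complex.digamma_one]
    have hQ : ∑ l ∈ Finset.range n, 1 / ((l : ℂ) + 1 / 2) ^ 2 =
        (π : ℂ) ^ 2 / 2 - polygamma 1 (1 / 2 + n) := by linear_combination hP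
    have hstep : 1 / (1 / 2 + ((n + 1 : ℕ) : ℂ)) *
        hypergeometric {1, 1, 1, 1} {2, 2, 3 / 2 + ((n + 1 : ℕ) : ℂ)} 1 =
        1 / (1 / 2 + (n : ℂ)) * hypergeometric {1, 1, 1, 1} {2, 2, 3 / 2 + (n : ℂ)} 1 -
          (polygamma 1 (1 / 2 + n) - 1 / ((n : ℂ) + 1 / 2) ^ 2) / ((n : ℂ) + 1 / 2) := by
      rw [hF, hP1, Nat.cast_succ, ← add_assoc, ← add_assoc,
        show (1 / 2 : ℂ) + n + 1 = n + 3 / 2 by ring,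
        show (3 / 2 + (n : ℂ) - 1) = n + 1 / 2 by ring, add_comm (1 / 2 : ℂ) n]
      rw [add_comm (3 / 2 : ℂ) n]
      generalize (n : ℂ) + 1 / 2 = s at hs
      generalize (n : ℂ) + 3 / 2 = t at hs1
      field_simp
      ring
    rw [hstep, ih, hT, h0, hQ, polygamma_one_half_add_natCast_succ,
      polygamma_two_half_add_natCast_succ, digamma_half_add_natCast_succ]
    -- The remaining finite sum is the same on both sides, so a rational identity in s = n+1/2 is
    -- left.
    generalize Finset.sum (M := ℂ) (Finset.range n) _ = S
    generalize (n : ℂ) + 1 / 2 = s at hs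
    field_simp
    ring

theorem IsContinuationOf4F3.three_halves_sub {G : ℂ → ℂ} (hG : IsContinuationOf4F3 G) (n : ℕ) :
    1 / (1 / 2 - (n : ℂ)) * G (3 / 2 - (n : ℂ)) =
      7 / 2 * riemannZeta 3 + 1 / 2 * polygamma 2 (1 / 2 + n)
        - (π : ℂ) ^ 2 * (Complex.digamma (1 / 2 + n)
            + 3 / 2 * (Real.eulerMascheroniConstant : ℂ) + (Real.log 2 : ℂ))
        + polygamma 1 (1 / 2 + n) * (2 * (Real.eulerMascheroniConstant : ℂ)
            + 2 * (Real.log 2 : ℂ) + Complex.digamma (n + 1 / 2))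
        - ∑ l ∈ Finset.range n,
            (Complex.digamma (1 + l) / ((l : ℂ) + 1 / 2) ^ 2
              - polygamma 1 (1 + l) *
                  (1 / ((l : ℂ) + 1 / 2) + 1 / ((l : ℂ) - n + 1 / 2))) := by
  induction n with
  | zero =>
    have h := digamma_half_add_natCast 0
    simp only [Nat.cast_zero, add_zero, zero_add, sub_zero, Finset.range_zero,
      Finset.sum_empty] at h ⊢
    rw [hG.eq_series _ (by norm_num), hypergeometric_three_halves, polygamma_two_half,
      polygamma_one_half, h]
    ring
  | succ n ih =>
    have hs := natCast_add_half_ne_zero n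
    have hs1 : (1 / 2 : ℂ) - n ≠ 0 := ne_zero_of_mem_polygammaDomain (half_sub_natCast_mem n)
    have hF := hG.add_one (half_sub_natCast_mem n)
    have hT := sum_range_shift_second (a := fun l => Complex.digamma (1 + l))
      (b := fun l => polygamma 1 (1 + l)) digamma_one_add_natCast_succ
      polygamma_one_one_add_natCast_succ n
    have h0 : Complex.digamma (1 + (0 : ℕ)) = -(Real.eulerMascheroniConstant : ℂ) := by
      rw [Nat.cast_zero, add_zero, Complex.digamma_one]
    have hQ : ∑ l ∈ Finset.range n, 1 / ((l : ℂ) + 1 / 2) = Complex.digamma (1 / 2 + n) +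
        2 * (Real.log 2 : ℂ) + (Real.eulerMascheroniConstant : ℂ) := by
      linear_combination -digamma_half_add_natCast n
    -- The recurrence at 1/2-n, divided by -(n+1/2), with ψ'(1/2-n) rewritten by reflection.
    have hstep : 1 / (1 / 2 - ((n + 1 : ℕ) : ℂ)) * G (3 / 2 - ((n + 1 : ℕ) : ℂ)) =
        1 / (1 / 2 - (n : ℂ)) * G (3 / 2 - (n : ℂ)) -
          ((π : ℂ) ^ 2 - polygamma 1 (1 / 2 + n)) / ((n : ℂ) + 1 / 2) := by
      rw [show (3 / 2 - ((n + 1 : ℕ) : ℂ)) = 1 / 2 - n by push_cast; ring, hF,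
        polygamma_one_half_sub_natCast,
        show (1 / 2 - ((n + 1 : ℕ) : ℂ)) = -((n : ℂ) + 1 / 2) by push_cast; ring,
        show (1 / 2 - (n : ℂ) - 1) = -((n : ℂ) + 1 / 2) by ring,
        show (1 / 2 - (n : ℂ) + 1) = 3 / 2 - n by ring]
      generalize (n : ℂ) + 1 / 2 = s at hs
      generalize (1 / 2 : ℂ) - n = t at hs1
      field_simp
      ring
    rw [add_comm (((n + 1 : ℕ) : ℂ)) (1 / 2), hstep, ih, hT, h0, hQ,
      polygamma_one_half_add_natCast_succ, polygamma_two_half_add_natCast_succ,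
      digamma_half_add_natCast_succ,
      show Complex.digamma ((n : ℂ) + 1 / 2) = Complex.digamma (1 / 2 + n) by rw [add_comm]]
    generalize Finset.sum (M := ℂ) (Finset.range n) _ = S
    generalize (n : ℂ) + 1 / 2 = s at hs
    field_simp
    ring

theorem hypergeometric_one_half :
    hypergeometric {1, 1, 1, 1} {2, 2, 1 / 2} 1 =
      7 / 4 * riemannZeta 3 + (π : ℂ) ^ 2 / 2 * (1 - (Real.log 2 : ℂ)) := by
  rw [hypergeometric_add_one (by norm_num), polygamma_one_half,
    show (1 / 2 : ℂ) + 1 = 3 / 2 by norm_num, hypergeometric_three_halves]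
  ring

theorem theorem2p3 :
    -- convergence of the series
    (∀ c : ℂ, 0 < c.re → Summable (hypergeometricTerm {1, 1, 1, 1} {2, 2, c} 1)) ∧
    -- the case `1/2 + n`
    (∀ n : ℕ,
      1 / (1 / 2 + (n : ℂ)) * hypergeometric {1, 1, 1, 1} {2, 2, 3 / 2 + (n : ℂ)} 1 =
        7 / 2 * riemannZeta 3 + 1 / 2 * polygamma 2 (1 / 2 + n)
          - (π : ℂ) ^ 2 / 2 * Complex.digamma (1 / 2 + n)
          - (Real.eulerMascheroniConstant : ℂ) * polygamma 1 (1 / 2 + n)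
          + ∑ l ∈ Finset.range n,
              (Complex.digamma (1 + l) / ((l : ℂ) - n + 1 / 2) ^ 2
                - polygamma 1 (1 + l) *
                    (1 / ((l : ℂ) + 1 / 2) + 1 / ((l : ℂ) - n + 1 / 2)))) ∧
    -- the case `1/2 - n`, in the sense of analytic continuation
    (∃ G : ℂ → ℂ, IsContinuationOf4F3 G) ∧
    (∀ G : ℂ → ℂ, IsContinuationOf4F3 G → ∀ n : ℕ,
      1 / (1 / 2 - (n : ℂ)) * G (3 / 2 - (n : ℂ)) =
        7 / 2 * riemannZeta 3 + 1 / 2 * polygamma 2 (1 / 2 + n)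
          - (π : ℂ) ^ 2 * (Complex.digamma (1 / 2 + n)
              + 3 / 2 * (Real.eulerMascheroniConstant : ℂ) + (Real.log 2 : ℂ))
          + polygamma 1 (1 / 2 + n) * (2 * (Real.eulerMascheroniConstant : ℂ)
              + 2 * (Real.log 2 : ℂ) + Complex.digamma (n + 1 / 2))
          - ∑ l ∈ Finset.range n,
              (Complex.digamma (1 + l) / ((l : ℂ) + 1 / 2) ^ 2
                - polygamma 1 (1 + l) *
                    (1 / ((l : ℂ) + 1 / 2) + 1 / ((l : ℂ) - n + 1 / 2)))) ∧
    -- the special values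
    hypergeometric {1, 1, 1, 1} {2, 2, 1 / 2} 1 =
      7 / 4 * riemannZeta 3 + (π : ℂ) ^ 2 / 2 * (1 - (Real.log 2 : ℂ)) ∧
    hypergeometric {1, 1, 1, 1} {2, 2, 3 / 2} 1 =
      -(7 / 4) * riemannZeta 3 + (π : ℂ) ^ 2 / 2 * (Real.log 2 : ℂ) := by
  exact ⟨fun c hc => summable_hypergeometricTerm hc, hypergeometric_three_halves_add,
    exists_isContinuationOf4F3, fun G hG => hG.three_halves_sub, hypergeometric_one_half,
    hypergeometric_three_halves⟩
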